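/- **Theorem 1.5.** Let $n\ge 2$, let $\mathbb T^n=\mathbb R^n/\Gamma$ for a full-rank lattice $\Gamma\subset\mathbb R^n$, let $I\subseteq\mathbb R$ be an open interval (possibly unbounded), and let $0<\alpha<1$. Let $v:I\times\mathbb T^n\to\mathbb R^n$ be measurable and let $p:I\times\mathbb T^n\to\mathbb R$ be locally integrable, normalized by $\int_{\mathbb T^n}p(t,x)\,dx=0$ for almost every $t\in I$. Suppose that $(v,p)$ solves the incompressible Euler equations $$\partial_t v+\operatorname{div}(v\otimes v)+\nabla p=0,\qquad \operatorname{div}v=0$$ in the sense of distributions on $I\times\mathbb T^n$, and that $$\operatorname*{ess\,sup}_{t\in I}\|v(t,\cdot)\|_{C^\alpha(\mathbb T^n)}<\infty ,\qquad \|f\|_{C^\alpha}=\sup_x|f(x)|+\sup_{x\ne y}\frac{|f(x)-f(y)|}{|x-y|^\alpha}.$$ Let $$e(t)=\int_{\mathbb T^n}\frac{|v(t,x)|^2}{2}\,dx .$$ Then there is a constant $C$, depending on $v$ and $\alpha$, such that $$|e(t+\Delta t)-e(t)|\le C\,|\Delta t|^{\frac{2\alpha}{1-\alpha}}\qquad(\ast)$$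 for all $t,\,t+\Delta t$ in some subset of $I$ of full measure. If moreover $t\mapsto v(t,x)$ is continuous on $I$ for every $x$, then $(\ast)$ holds, with the same $C$, for all $t,\,t+\Delta t\in I$. -/

import Mathlib

open MeasureTheory Set
open scoped ContDiff

namespace EulerTorus

/-- Euclidean space `ℝⁿ`. -/
abbrev E (n : ℕ) : Type := EuclideanSpace ℝ (Fin n)

/-- Functions on `I × 𝕋ⁿ`, where `𝕋ⁿ = ℝⁿ / Γ` and `Γ` is the lattice generated over `ℤ` by the
basis `b` of `ℝⁿ`, are functions of `(t, x) ∈ I × ℝⁿ` that are `Γ`-periodic in `x`.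
Every full-rank lattice of `ℝⁿ` is of this form. -/
def PeriodicOn {n : ℕ} {F : Type*} (b : Module.Basis (Fin n) ℝ (E n)) (I : Set ℝ)
    (f : ℝ → E n → F) : Prop :=
  ∀ t ∈ I, ∀ x : E n, ∀ γ ∈ Submodule.span ℤ (range b), f t (x + γ) = f t x

/-- Smooth real-valued test functions on space-time with compact support inside `I × ℝⁿ`. -/
structure IsTestFunction {n : ℕ} (I : Set ℝ) (φ : ℝ × E n → ℝ) : Prop where
  smooth : ContDiff ℝ ∞ φ
  compactSupport : HasCompactSupport φ
  support_subset : tsupport φ ⊆ I ×ˢ univ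

/-- The time derivative `∂ₜ φ`. -/
noncomputable def dt {n : ℕ} (φ : ℝ × E n → ℝ) (z : ℝ × E n) : ℝ :=
  fderiv ℝ φ z (1, 0)

/-- The space derivative `∂ⱼ φ`. -/
noncomputable def dx {n : ℕ} (j : Fin n) (φ : ℝ × E n → ℝ) (z : ℝ × E n) : ℝ :=
  fderiv ℝ φ z (0, EuclideanSpace.single j 1)

/-- `(v, p)` solves the incompressible Euler equations
`∂ₜ vˡ + ∂ⱼ (vʲ vˡ) + ∂ₗ p = 0`, `∂ⱼ vʲ = 0` on `I × 𝕋ⁿ` in the sense of distributions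
(distributions on the torus being regarded as periodic distributions on `ℝⁿ`). -/
structure IsEulerSolution {n : ℕ} (b : Module.Basis (Fin n) ℝ (E n)) (I : Set ℝ)
    (v : ℝ → E n → E n) (p : ℝ → E n → ℝ) : Prop where
  velocity_periodic : PeriodicOn b I v
  pressure_periodic : PeriodicOn b I p
  velocity_measurable :
    AEStronglyMeasurable (fun z : ℝ × E n => v z.1 z.2) (volume.restrict (I ×ˢ univ))
  velocity_sq_integrable :
    LocallyIntegrableOn (fun z : ℝ × E n => ‖v z.1 z.2‖ ^ 2) (I ×ˢ univ)
  pressure_integrable :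
    LocallyIntegrableOn (fun z : ℝ × E n => p z.1 z.2) (I ×ˢ univ)
  momentum : ∀ φ : ℝ × E n → ℝ, IsTestFunction I φ → ∀ l : Fin n,
    ∫ z in I ×ˢ univ, (v z.1 z.2 l * dt φ z + (∑ j, v z.1 z.2 j * v z.1 z.2 l * dx j φ z)
      + p z.1 z.2 * dx l φ z) = 0
  incompressible : ∀ φ : ℝ × E n → ℝ, IsTestFunction I φ →
    ∫ z in I ×ˢ univ, (∑ j, v z.1 z.2 j * dx j φ z) = 0

/-- The pressure has integral `0` over the torus, at almost every time. -/
def PressureNormalized {n : ℕ} (b : Module.Basis (Fin n) ℝ (E n)) (I : Set ℝ)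
    (p : ℝ → E n → ℝ) : Prop :=
  ∀ᵐ t ∂(volume.restrict I), ∫ x in ZSpan.fundamentalDomain b, p t x = 0

/-- The norms `‖v(t, ·)‖_{C^α}` (supremum norm plus `α`-Hölder seminorm) are bounded uniformly
over almost every `t ∈ I`. -/
def BoundedHolder {n : ℕ} (α : ℝ) (I : Set ℝ) (v : ℝ → E n → E n) : Prop :=
  ∃ M : ℝ, ∀ᵐ t ∂(volume.restrict I),
    (∀ x, ‖v t x‖ ≤ M) ∧ ∀ x y, ‖v t x - v t y‖ ≤ M * ‖x - y‖ ^ α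

/-- The energy profile `e(t) = ∫_{𝕋ⁿ} |v(t, x)|² / 2 dx`. -/
noncomputable def energy {n : ℕ} (b : Module.Basis (Fin n) ℝ (E n))
    (v : ℝ → E n → E n) (t : ℝ) : ℝ :=
  ∫ x in ZSpan.fundamentalDomain b, ‖v t x‖ ^ 2 / 2

end EulerTorus

/-! Mollify at scale ε with an even kernel ψ, and compare `energy` with the quadratic form ½⟨w, ψ∗w⟩
(`mollEnergy`) in place of ½‖ψ∗w‖². The difference is a ψ-weighted mean of squared increments of w,
hence O(ε^{2α}) (`abs_energy_sub_mollEnergy_le`).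

It remains to show that the mollified energy is Lipschitz in time with constant O(ε^{3α−1}). Since ψ
is even, its increment between times s and t equals ½⟨w(t)+w(s), ψ∗(w(t)−w(s))⟩, and the last factor
is given by the time-integrated momentum equation. The pressure contributes nothing, because w(t)
and w(s) are divergence free. What is left is an integral over r ∈ [s,t] of `flux` with w⊗w taken at
time r and the mollified velocity at time s or t (`mollEnergy_sub`).

When both times equal r, the Constantin–E–Titi/Duchon–Robert identity writes the flux as a cubic
expression in the increments of w, integrated against ∇ψ; this gives O(ε^{3α−1}) (`abs_flux_le`).
Replacing s or t by r costs at most a constant depending on ψ times ∫_s^t of a locally integrable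
weight (`abs_flux_sub_le`); only local integrability of the pressure enters. That constant is
harmful as ε → 0, but the error in the increment is (t−s) times an integral over [s,t], so
subdividing [s,t] removes it altogether (`abs_sub_le_of_increment_bound`).

Altogether |e(t)−e(s)| ≲ ε^{2α} + ε^{3α−1}|t−s|, and the choice ε ≈ |t−s|^{1/(1−α)} balances the two
terms. Dyadic values of ε keep the number of exceptional null sets countable. -/

namespace EulerTorus

/-! ### Periodic functions, correlations and mollification over a fundamental cell. -/

section Torus

open scoped Pointwise

variable {n : ℕ} {F : Type*}

/-- Periodicity with respect to the lattice generated by `b`. -/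
def IsPeriodic (b : Module.Basis (Fin n) ℝ (E n)) (f : E n → F) : Prop :=
  ∀ x, ∀ γ ∈ Submodule.span ℤ (range b), f (x + γ) = f x

/-- The correlation of a function with a kernel. -/
noncomputable def moll (k q : E n → ℝ) (x : E n) : ℝ := ∫ z, q (x + z) * k z

/-- The correlation of two periodic functions over a fundamental cell. -/
noncomputable def corr (b : Module.Basis (Fin n) ℝ (E n)) (u h : E n → ℝ) (z : E n) : ℝ :=
  ∫ x in ZSpan.fundamentalDomain b, u x * h (x + z)

variable {b : Module.Basis (Fin n) ℝ (E n)}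

lemma IsPeriodic.comp_add {f : E n → F} (hf : IsPeriodic b f) (z : E n) :
    IsPeriodic b (fun x => f (x + z)) := fun x γ hγ => by
  have := hf (x + z) γ hγ
  rwa [add_right_comm] at this

lemma IsPeriodic.map {G : Type*} {f : E n → F} (hf : IsPeriodic b f) (g : F → G) :
    IsPeriodic b (fun x => g (f x)) := fun x γ hγ => congrArg g (hf x γ hγ)

lemma IsPeriodic.map₂ {G H : Type*} {f : E n → F} {g : E n → G} (hf : IsPeriodic b f)
    (hg : IsPeriodic b g) (m : F → G → H) : IsPeriodic b (fun x => m (f x) (g x)) :=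
  fun x γ hγ => by simp only [hf x γ hγ, hg x γ hγ]

lemma integral_cell_add {f : E n → ℝ} (hf : IsPeriodic b f) (z : E n) :
    ∫ x in ZSpan.fundamentalDomain b, f (x + z) = ∫ x in ZSpan.fundamentalDomain b, f x := by
  have hD := ZSpan.isAddFundamentalDomain b (volume : Measure (E n))
  have h1 := (measurePreserving_add_right (volume : Measure (E n)) z).setIntegral_image_emb
    (MeasurableEquiv.addRight z).measurableEmbedding f (ZSpan.fundamentalDomain b)
  rw [← h1]
  have : VAddInvariantMeasure (Submodule.span ℤ (range b)) (E n) volume :=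
    ⟨fun c s _ => by
      simp [Submodule.vadd_def]⟩
  -- Translations commute with the lattice action, so the translated cell is again a fundamental
  -- domain, and a periodic function has the same integral over both.
  have hD' := hD.vadd_of_comm (G' := E n) z
  have : (fun x => x + z) '' ZSpan.fundamentalDomain b = z +ᵥ ZSpan.fundamentalDomain b := by
    ext y
    simp only [mem_image, mem_vadd_set, vadd_eq_add, add_comm z]
  rw [this]
  refine hD'.setIntegral_eq hD fun g x => ?_
  rw [Submodule.vadd_def, vadd_eq_add, add_comm]
  exact hf x g g.2

lemma volume_cell_lt_top : volume (ZSpan.fundamentalDomain b) < ⊤ :=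
  (ZSpan.fundamentalDomain_isBounded b).measure_lt_top

instance : IsFiniteMeasure ((volume : Measure (E n)).restrict (ZSpan.fundamentalDomain b)) :=
  ⟨by simpa using volume_cell_lt_top⟩

lemma integrableOn_cell {h : E n → ℝ} (hh : LocallyIntegrable h) :
    IntegrableOn h (ZSpan.fundamentalDomain b) :=
  (hh.integrableOn_isCompact (ZSpan.fundamentalDomain_isBounded b).isCompact_closure).mono_set
    subset_closure

lemma locallyIntegrable_comp_add {h : E n → ℝ} (hh : LocallyIntegrable h) (z : E n) :
    LocallyIntegrable (fun x => h (x + z)) := by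
  rw [locallyIntegrable_iff] at hh ⊢
  intro K hK
  have := hh _ (hK.image (f := fun x : E n => x + z) (by fun_prop))
  exact ((measurePreserving_add_right (volume : Measure (E n)) z).integrableOn_image
    (MeasurableEquiv.addRight z).measurableEmbedding).1 this

lemma locallyIntegrable_norm {h : E n → ℝ} (hh : LocallyIntegrable h) :
    LocallyIntegrable (fun x => ‖h x‖) := by
  rw [locallyIntegrable_iff] at hh ⊢
  exact fun K hK => (hh K hK).norm

lemma aestronglyMeasurable_comp_add {h : E n → ℝ} (hh : AEStronglyMeasurable h) :
    AEStronglyMeasurable (fun p : E n × E n => h (p.1 + p.2))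
      ((volume.restrict (ZSpan.fundamentalDomain b)).prod volume) :=
  hh.comp_quasiMeasurePreserving (quasiMeasurePreserving_add _ _)

/-- Translation invariance makes the L¹ norm of h(· + z) over the cell independent of z, so the
slices are dominated by a multiple of |k(z)|. Local integrability of h suffices, which is all that
the time-integrated pressure offers. -/
lemma integrable_pairing_left {u h k : E n → ℝ} {C : ℝ} (hu : AEStronglyMeasurable u)
    (huC : ∀ x, |u x| ≤ C) (hh : LocallyIntegrable h) (hper : IsPeriodic b h) (hk : Integrable k) :
    Integrable (fun p : E n × E n => u p.1 * (h (p.1 + p.2) * k p.2))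
      ((volume.restrict (ZSpan.fundamentalDomain b)).prod volume) := by
  have hm : AEStronglyMeasurable (fun p : E n × E n => u p.1 * (h (p.1 + p.2) * k p.2))
      ((volume.restrict (ZSpan.fundamentalDomain b)).prod volume) :=
    hu.restrict.comp_fst.mul ((aestronglyMeasurable_comp_add hh.aestronglyMeasurable).mul
      hk.aestronglyMeasurable.comp_snd)
  rw [integrable_prod_iff' hm]
  refine ⟨.of_forall fun z => ?_, ?_⟩
  · have := (integrableOn_cell (b := b) (locallyIntegrable_comp_add hh z)).mul_const (k z)
    exact this.bdd_mul hu.restrict (.of_forall huC)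
  · refine Integrable.mono' (g := fun z => C * (∫ x in ZSpan.fundamentalDomain b, |h x|) * |k z|)
      (hk.abs.const_mul _) hm.norm.prod_swap.integral_prod_right' (.of_forall fun z => ?_)
    rw [Real.norm_of_nonneg (integral_nonneg fun _ => norm_nonneg _)]
    calc ∫ x in ZSpan.fundamentalDomain b, ‖u x * (h (x + z) * k z)‖
        ≤ ∫ x in ZSpan.fundamentalDomain b, C * |h (x + z)| * |k z| := by
          refine integral_mono_of_nonneg (.of_forall fun _ => norm_nonneg _)
            (((integrableOn_cell (locallyIntegrable_comp_add hh z)).abs.const_mul C).mul_const _)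
            (.of_forall fun x => ?_)
          simp only [norm_mul, Real.norm_eq_abs]
          rw [mul_assoc]
          gcongr
          exact huC x
      _ = _ := by
          rw [integral_mul_const, integral_const_mul,
            integral_cell_add (f := fun x => |h x|) (hper.map _) z]

lemma integrable_pairing_right {u h k : E n → ℝ} {C : ℝ} (hu : AEStronglyMeasurable u)
    (huC : ∀ x, |u x| ≤ C) (hh : LocallyIntegrable h) (hk : Integrable k) :
    Integrable (fun p : E n × E n => h p.1 * (u (p.1 + p.2) * k p.2))
      ((volume.restrict (ZSpan.fundamentalDomain b)).prod volume) := by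
  have h1 : Integrable (fun p : E n × E n => h p.1 * k p.2)
      ((volume.restrict (ZSpan.fundamentalDomain b)).prod volume) :=
    (integrableOn_cell hh).mul_prod hk
  have := h1.bdd_mul (aestronglyMeasurable_comp_add (b := b) hu) (.of_forall fun p => huC _)
  exact this.congr (.of_forall fun p => by simp only; ring)

lemma integral_mul_moll_of_integrable {u h k : E n → ℝ}
    (H : Integrable (fun p : E n × E n => u p.1 * (h (p.1 + p.2) * k p.2))
      ((volume.restrict (ZSpan.fundamentalDomain b)).prod volume)) :
    ∫ x in ZSpan.fundamentalDomain b, u x * moll k h x = ∫ z, corr b u h z * k z := by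
  simp only [moll, corr, ← integral_const_mul, ← integral_mul_const]
  rw [integral_integral_swap H]
  simp only [mul_assoc]

lemma corr_neg {u h : E n → ℝ} (hu : IsPeriodic b u) (hh : IsPeriodic b h) (z : E n) :
    corr b u h (-z) = corr b h u z := by
  unfold corr
  rw [← integral_cell_add (f := fun x => u x * h (x + -z))
    (hu.map₂ (hh.comp_add _) (· * ·)) z]
  simp [mul_comm]

/-- Moving a kernel from one factor of a pairing over the torus to the other. -/
lemma integral_mul_moll_swap {u h k : E n → ℝ} {C : ℝ} (hu : AEStronglyMeasurable u)
    (huC : ∀ x, |u x| ≤ C) (hup : IsPeriodic b u) (hh : LocallyIntegrable h)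
    (hper : IsPeriodic b h) (hk : Integrable k) :
    ∫ x in ZSpan.fundamentalDomain b, u x * moll k h x =
      ∫ x in ZSpan.fundamentalDomain b, h x * moll (fun z => k (-z)) u x := by
  rw [integral_mul_moll_of_integrable (integrable_pairing_left hu huC hh hper hk),
    integral_mul_moll_of_integrable (integrable_pairing_right hu huC hh hk.comp_neg),
    ← integral_neg_eq_self]
  simp only [corr_neg hup hper]

/-- In this form the mollification is the pairing of q with the test function y ↦ k(y − x).
Derivatives of that test function in y fall on k without a sign. -/
lemma moll_eq (k q : E n → ℝ) (x : E n) : moll k q x = ∫ y, q y * k (y - x) := by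
  rw [← integral_add_left_eq_self (fun y => q y * k (y - x)) x]
  simp [moll]

lemma continuous_moll {k q : E n → ℝ} (hk : Continuous k) (hks : HasCompactSupport k)
    (hq : LocallyIntegrable q) : Continuous (moll k q) := by
  have h1 : HasCompactSupport (fun z => k (-z)) := hks.comp_homeomorph (Homeomorph.neg (E n))
  have := h1.continuous_convolution_right (ContinuousLinearMap.mul ℝ ℝ) hq
    (hk.comp continuous_neg)
  convert this using 1
  ext x
  simp [moll_eq, convolution]

lemma abs_moll_le {k q : E n → ℝ} {C : ℝ} (hk : Integrable k) (hq : ∀ x, |q x| ≤ C) (x : E n) :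
    |moll k q x| ≤ C * ∫ z, |k z| := by
  rw [← integral_const_mul]
  rw [← Real.norm_eq_abs, moll]
  refine norm_integral_le_of_norm_le (hk.abs.const_mul C) (.of_forall fun z => ?_)
  rw [norm_mul, Real.norm_eq_abs, Real.norm_eq_abs]
  gcongr
  exact hq _

/-- Young's inequality on the torus. -/
lemma integral_abs_moll_le {k q : E n → ℝ} (hk : Integrable k) (hq : LocallyIntegrable q)
    (hper : IsPeriodic b q) :
    ∫ x in ZSpan.fundamentalDomain b, |moll k q x| ≤
      (∫ x in ZSpan.fundamentalDomain b, |q x|) * ∫ z, |k z| := by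
  have H := integrable_pairing_left (b := b) (u := fun _ => 1) (C := 1)
    aestronglyMeasurable_const (by simp) (locallyIntegrable_norm hq) (hper.map _) hk.abs
  have H2 := integral_mul_moll_of_integrable (b := b) (u := fun _ => 1)
    (h := fun x => ‖q x‖) (k := fun z => |k z|) H
  have H3 := H.integral_prod_left
  simp only [one_mul] at H2 H3
  calc _ ≤ ∫ x in ZSpan.fundamentalDomain b, moll (fun z => |k z|) (fun x => ‖q x‖) x := by
        refine integral_mono_of_nonneg (.of_forall fun _ => abs_nonneg _) H3
          (.of_forall fun x => ?_)
        refine (abs_integral_le_integral_abs).trans (le_of_eq ?_)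
        simp [moll, abs_mul]
    _ = _ := by
        rw [H2, ← integral_const_mul]
        congr 1; ext z
        rw [corr]
        simp only [one_mul]
        rw [integral_cell_add (f := fun x => ‖q x‖) (hper.map _) z]
        rfl

end Torus

/-! ### Smooth cutoffs in time and Lebesgue points. -/

section TimeCutoff

open Filter Topology

/-- Bump functions on the line concentrating at the origin. -/
noncomputable def bumpSeq (k : ℕ) : ContDiffBump (0 : ℝ) where
  rIn := 1 / (k + 1)
  rOut := 2 / (k + 1)
  rIn_pos := by positivity
  rIn_lt_rOut := by gcongr; norm_num

/-- The normalized bump functions. -/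
noncomputable def bumpKernel (k : ℕ) : ℝ → ℝ := (bumpSeq k).normed volume

lemma bumpSeq_rOut (k : ℕ) : (bumpSeq k).rOut = 2 / (k + 1) := rfl

lemma tendsto_bumpSeq_rOut : Tendsto (fun k => (bumpSeq k).rOut) atTop (𝓝 0) := by
  have := (tendsto_one_div_add_atTop_nhds_zero_nat (𝕜 := ℝ)).const_mul 2
  simpa [bumpSeq_rOut, div_eq_mul_inv] using this

lemma continuous_bumpKernel (k : ℕ) : Continuous (bumpKernel k) :=
  (bumpSeq k).continuous_normed

lemma integrable_bumpKernel (k : ℕ) : Integrable (bumpKernel k) :=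
  (bumpSeq k).integrable_normed

lemma bumpKernel_nonneg (k : ℕ) (x : ℝ) : 0 ≤ bumpKernel k x :=
  (bumpSeq k).nonneg_normed x

lemma bumpKernel_eq_zero {k : ℕ} {x : ℝ} (hx : 2 / ((k : ℝ) + 1) ≤ |x|) : bumpKernel k x = 0 := by
  by_contra h
  have : x ∈ Function.support ((bumpSeq k).normed volume) := h
  rw [ContDiffBump.support_normed_eq] at this
  simp [bumpSeq_rOut] at this
  linarith

/-- Lebesgue differentiation: the ratio of outer to inner radius stays equal to 2, so the bumps
shrink regularly. This recovers values at individual times from the weak equation. -/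
lemma ae_tendsto_integral_bumpKernel {f : ℝ → ℝ} (hf : LocallyIntegrable f) :
    ∀ᵐ s, Tendsto (fun k => ∫ u, bumpKernel k (u - s) * f u) atTop (𝓝 (f s)) := by
  have := ContDiffBump.ae_convolution_tendsto_right_of_locallyIntegrable
    (K := 2) tendsto_bumpSeq_rOut (.of_forall fun k => by simp [bumpSeq, div_eq_mul_inv]) hf
  filter_upwards [this] with s hs
  convert hs using 2 with k
  rw [convolution_lsmul_swap]
  congr 1; ext u
  rw [← neg_sub, bumpKernel, ContDiffBump.normed_neg, smul_eq_mul]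

/-- A smooth approximation of the indicator function of `[s, t]`. -/
noncomputable def ramp (k : ℕ) (s t r : ℝ) : ℝ := ∫ u in (r - t)..(r - s), bumpKernel k u

/-- Testing the equation with `ramp` thus turns the time derivative into an average near s minus an
average near t. -/
lemma hasDerivAt_ramp (k : ℕ) (s t r : ℝ) :
    HasDerivAt (ramp k s t) (bumpKernel k (r - s) - bumpKernel k (r - t)) r := by
  have hP : ∀ x, HasDerivAt (fun x => ∫ u in (0 : ℝ)..x, bumpKernel k u) (bumpKernel k x) x :=
    fun x => (continuous_bumpKernel k).integral_hasStrictDerivAt 0 x |>.hasDerivAt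
  have h := ((hP (r - s)).comp_sub_const r s).sub ((hP (r - t)).comp_sub_const r t)
  refine h.congr_of_eventuallyEq (.of_forall fun r => ?_)
  simp only [ramp, Pi.sub_apply]
  rw [intervalIntegral.integral_interval_sub_left] <;>
    exact (continuous_bumpKernel k).intervalIntegrable _ _

lemma deriv_ramp (k : ℕ) (s t : ℝ) :
    deriv (ramp k s t) = fun r => bumpKernel k (r - s) - bumpKernel k (r - t) :=
  funext fun r => (hasDerivAt_ramp k s t r).deriv

lemma contDiff_ramp (k : ℕ) (s t : ℝ) : ContDiff ℝ ∞ (ramp k s t) := by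
  rw [contDiff_infty_iff_deriv, deriv_ramp]
  refine ⟨fun r => (hasDerivAt_ramp k s t r).differentiableAt, ?_⟩
  have : ContDiff ℝ ∞ (bumpKernel k) := (bumpSeq k).contDiff_normed
  fun_prop

lemma ramp_nonneg (k : ℕ) {s t : ℝ} (hst : s ≤ t) (r : ℝ) : 0 ≤ ramp k s t r :=
  intervalIntegral.integral_nonneg (by linarith) fun u _ => bumpKernel_nonneg k u

lemma ramp_le_one (k : ℕ) {s t : ℝ} (hst : s ≤ t) (r : ℝ) : ramp k s t r ≤ 1 := by
  rw [ramp, intervalIntegral.integral_of_le (by linarith), ← (bumpSeq k).integral_normed (μ := volume)]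
  exact setIntegral_le_integral (integrable_bumpKernel k) (.of_forall (bumpKernel_nonneg k))

lemma ramp_eq_zero {k : ℕ} {s t r : ℝ} (hst : s ≤ t)
    (hr : r ∉ Icc (s - 2 / ((k : ℝ) + 1)) (t + 2 / ((k : ℝ) + 1))) : ramp k s t r = 0 := by
  rw [ramp, intervalIntegral.integral_of_le (by linarith)]
  refine setIntegral_eq_zero_of_forall_eq_zero fun u hu => bumpKernel_eq_zero ?_
  rw [mem_Icc, not_and_or, not_le, not_le] at hr
  rw [mem_Ioc] at hu
  rw [le_abs]
  rcases hr with hr | hr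
  · right; linarith
  · left; linarith

lemma tsupport_ramp_subset (k : ℕ) {s t : ℝ} (hst : s ≤ t) :
    tsupport (ramp k s t) ⊆ Icc (s - 2 / ((k : ℝ) + 1)) (t + 2 / ((k : ℝ) + 1)) :=
  closure_minimal (fun r hr => by by_contra h; exact hr (ramp_eq_zero hst h)) isClosed_Icc

lemma hasCompactSupport_ramp (k : ℕ) {s t : ℝ} (hst : s ≤ t) : HasCompactSupport (ramp k s t) :=
  isCompact_Icc.of_isClosed_subset (isClosed_tsupport _) (tsupport_ramp_subset k hst)

lemma eventually_two_div_lt {δ : ℝ} (hδ : 0 < δ) : ∀ᶠ k : ℕ in atTop, 2 / ((k : ℝ) + 1) < δ :=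
  tendsto_bumpSeq_rOut.eventually_lt_const hδ

/-- The sequence is eventually constant at r, namely once the bump radius drops below the distances
from r to the endpoints. -/
lemma tendsto_ramp {s t r : ℝ} (hst : s ≤ t) (hs : r ≠ s) (ht : r ≠ t) :
    Tendsto (fun k => ramp k s t r) atTop (𝓝 ((Icc s t).indicator (fun _ => 1) r)) := by
  refine tendsto_const_nhds.congr' ?_
  by_cases h : r ∈ Icc s t
  · have h1 : 0 < r - s := sub_pos.2 (lt_of_le_of_ne h.1 hs.symm)
    have h2 : 0 < t - r := sub_pos.2 (lt_of_le_of_ne h.2 ht)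
    filter_upwards [eventually_two_div_lt h1, eventually_two_div_lt h2] with k hk1 hk2
    rw [indicator_of_mem h, ramp, intervalIntegral.integral_of_le (by linarith),
      ← (bumpSeq k).integral_normed (μ := volume), eq_comm]
    refine setIntegral_eq_integral_of_forall_compl_eq_zero fun u hu => bumpKernel_eq_zero ?_
    rw [mem_Ioc, not_and_or, not_lt, not_le] at hu
    rw [le_abs]
    rcases hu with hu | hu
    · right; linarith
    · left; linarith
  · rw [indicator_of_notMem h]
    rw [mem_Icc, not_and_or, not_le, not_le] at h
    rcases h with h | h
    · filter_upwards [eventually_two_div_lt (sub_pos.2 h)] with k hk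
      exact (ramp_eq_zero hst fun h' => by linarith [h'.1]).symm
    · filter_upwards [eventually_two_div_lt (sub_pos.2 h)] with k hk
      exact (ramp_eq_zero hst fun h' => by linarith [h'.2]).symm

end TimeCutoff

/-! ### Product test functions in time and space. -/

section TestFunctions

variable {n : ℕ}

/-- The partial derivative of a function on space. -/
noncomputable def pd (j : Fin n) (φ : E n → ℝ) (z : E n) : ℝ :=
  fderiv ℝ φ z (EuclideanSpace.single j 1)

lemma contDiff_pd {φ : E n → ℝ} (hφ : ContDiff ℝ ∞ φ) (j : Fin n) : ContDiff ℝ ∞ (pd j φ) :=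
  (hφ.fderiv_right (m := ∞) (by simp)).clm_apply contDiff_const

lemma hasCompactSupport_pd {φ : E n → ℝ} (hφ : HasCompactSupport φ) (j : Fin n) :
    HasCompactSupport (pd j φ) :=
  (hφ.fderiv (𝕜 := ℝ)).comp_left (g := fun L : E n →L[ℝ] ℝ => L (EuclideanSpace.single j 1)) rfl

lemma hasFDerivAt_mul_test {η : ℝ → ℝ} {φ : E n → ℝ} (hη : ContDiff ℝ ∞ η) (hφ : ContDiff ℝ ∞ φ)
    (x : E n) (z : ℝ × E n) :
    HasFDerivAt (fun z : ℝ × E n => η z.1 * φ (z.2 - x))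
      (η z.1 • (fderiv ℝ φ (z.2 - x)).comp (ContinuousLinearMap.snd ℝ ℝ (E n)) +
        φ (z.2 - x) • (fderiv ℝ η z.1).comp (ContinuousLinearMap.fst ℝ ℝ (E n))) z := by
  have h1 : HasFDerivAt (fun z : ℝ × E n => η z.1)
      ((fderiv ℝ η z.1).comp (ContinuousLinearMap.fst ℝ ℝ (E n))) z :=
    (hη.differentiable (by simp) z.1).hasFDerivAt.comp z hasFDerivAt_fst
  have h2 : HasFDerivAt (fun z : ℝ × E n => φ (z.2 - x))
      ((fderiv ℝ φ (z.2 - x)).comp (ContinuousLinearMap.snd ℝ ℝ (E n))) z :=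
    (hφ.differentiable (by simp) (z.2 - x)).hasFDerivAt.comp z (hasFDerivAt_snd.sub_const x)
  exact h1.mul h2

lemma dt_mul_test {η : ℝ → ℝ} {φ : E n → ℝ} (hη : ContDiff ℝ ∞ η) (hφ : ContDiff ℝ ∞ φ)
    (x : E n) (z : ℝ × E n) :
    dt (fun z : ℝ × E n => η z.1 * φ (z.2 - x)) z = deriv η z.1 * φ (z.2 - x) := by
  rw [dt, (hasFDerivAt_mul_test hη hφ x z).fderiv]
  simp [mul_comm]

lemma dx_mul_test {η : ℝ → ℝ} {φ : E n → ℝ} (hη : ContDiff ℝ ∞ η) (hφ : ContDiff ℝ ∞ φ)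
    (x : E n) (j : Fin n) (z : ℝ × E n) :
    dx j (fun z : ℝ × E n => η z.1 * φ (z.2 - x)) z = η z.1 * pd j φ (z.2 - x) := by
  rw [dx, (hasFDerivAt_mul_test hη hφ x z).fderiv]
  simp [pd]

lemma isTestFunction_mul {η : ℝ → ℝ} {φ : E n → ℝ} {I : Set ℝ} (hη : ContDiff ℝ ∞ η)
    (hηc : HasCompactSupport η) (hηI : tsupport η ⊆ I) (hφ : ContDiff ℝ ∞ φ)
    (hφc : HasCompactSupport φ) (x : E n) :
    IsTestFunction I (fun z : ℝ × E n => η z.1 * φ (z.2 - x)) := by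
  have hφx : HasCompactSupport (fun y => φ (y - x)) :=
    hφc.comp_homeomorph (Homeomorph.subRight x)
  have hsub : tsupport (fun z : ℝ × E n => η z.1 * φ (z.2 - x)) ⊆
      tsupport η ×ˢ tsupport (fun y => φ (y - x)) := by
    refine closure_minimal (fun z hz => ?_) ((isClosed_tsupport _).prod (isClosed_tsupport _))
    exact ⟨subset_tsupport _ (left_ne_zero_of_mul hz),
      subset_tsupport (fun y => φ (y - x)) (right_ne_zero_of_mul hz)⟩
  refine ⟨?_, (hηc.isCompact.prod hφx.isCompact).of_isClosed_subset (isClosed_tsupport _) hsub,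
    hsub.trans (prod_mono hηI (subset_univ _))⟩
  have h1 : ContDiff ℝ ∞ (fun z : ℝ × E n => η z.1) := hη.comp contDiff_fst
  have h2 : ContDiff ℝ ∞ (fun z : ℝ × E n => φ (z.2 - x)) :=
    hφ.comp (contDiff_snd.sub contDiff_const)
  exact h1.mul h2

end TestFunctions

/-! ### Integration over strips in space-time. -/

section SpaceTime

open Filter Topology

variable {n : ℕ}

lemma volume_restrict_prod_univ (s : Set ℝ) :
    (volume : Measure (ℝ × E n)).restrict (s ×ˢ univ) = (volume.restrict s).prod volume := by
  rw [Measure.volume_eq_prod, ← Measure.prod_restrict, Measure.restrict_univ]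

/-- Integrability on compact subsets of the strip `I × ℝⁿ`. -/
def StripIntegrable (I : Set ℝ) (G : ℝ × E n → ℝ) : Prop :=
  ∀ s t, Icc s t ⊆ I → ∀ K : Set (E n), IsCompact K → IntegrableOn G (Icc s t ×ˢ K)

lemma StripIntegrable.of_locallyIntegrableOn {I : Set ℝ} {G : ℝ × E n → ℝ}
    (hG : LocallyIntegrableOn G (I ×ˢ univ)) : StripIntegrable I G := fun _ _ hst _ hK =>
  hG.integrableOn_compact_subset (prod_mono hst (subset_univ _)) (isCompact_Icc.prod hK)

lemma StripIntegrable.of_bounded {I : Set ℝ} {G : ℝ × E n → ℝ} {C : ℝ}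
    (hG : AEStronglyMeasurable G) (hC : ∀ z, |G z| ≤ C) : StripIntegrable I G :=
  fun _ _ _ _ hK => Measure.integrableOn_of_bounded
    (isCompact_Icc.prod hK).measure_lt_top.ne hG (.of_forall hC)

lemma StripIntegrable.integrableOn_mul {I : Set ℝ} {G : ℝ × E n → ℝ} (hG : StripIntegrable I G)
    {k : E n → ℝ} (hk : Continuous k) (hks : HasCompactSupport k) (x : E n) {s t : ℝ}
    (hst : Icc s t ⊆ I) :
    IntegrableOn (fun z => G z * k (z.2 - x)) (Icc s t ×ˢ univ) := by
  have hkx : HasCompactSupport (fun y => k (y - x)) :=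
    hks.comp_homeomorph (Homeomorph.subRight x)
  obtain ⟨C, hC⟩ := hk.bounded_above_of_compact_support hks
  have h1 := Integrable.mul_bdd (g := fun z : ℝ × E n => k (z.2 - x)) (c := C)
    (hG s t hst _ hkx.isCompact)
    (by fun_prop : Continuous fun z : ℝ × E n => k (z.2 - x)).aestronglyMeasurable
    (.of_forall fun z => hC _)
  refine IntegrableOn.of_forall_sdiff_eq_zero h1 (measurableSet_Icc.prod .univ) fun z hz => ?_
  have : z.2 ∉ tsupport (fun y => k (y - x)) := fun h => hz.2 ⟨hz.1.1, h⟩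
  have h0 : k (z.2 - x) = 0 := image_eq_zero_of_notMem_tsupport (f := fun y => k (y - x)) this
  rw [h0, mul_zero]

lemma StripIntegrable.integral_mul {I : Set ℝ} {G : ℝ × E n → ℝ} (hG : StripIntegrable I G)
    {k : E n → ℝ} (hk : Continuous k) (hks : HasCompactSupport k) (x : E n) {s t : ℝ}
    (hst : Icc s t ⊆ I) :
    ∫ z in Icc s t ×ˢ univ, G z * k (z.2 - x) = moll k (fun y => ∫ r in Icc s t, G (r, y)) x := by
  have h := hG.integrableOn_mul hk hks x hst
  rw [IntegrableOn, volume_restrict_prod_univ] at h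
  rw [volume_restrict_prod_univ, integral_prod_symm _ h, moll_eq]
  simp only [integral_mul_const]

lemma StripIntegrable.locallyIntegrable {I : Set ℝ} {G : ℝ × E n → ℝ} (hG : StripIntegrable I G)
    {s t : ℝ} (hst : Icc s t ⊆ I) : LocallyIntegrable (fun y => ∫ r in Icc s t, G (r, y)) := by
  rw [locallyIntegrable_iff]
  intro K hK
  have := hG s t hst K hK
  rw [IntegrableOn, Measure.volume_eq_prod, ← Measure.prod_restrict] at this
  exact this.integral_prod_right

lemma exists_Icc_subset {I : Set ℝ} (hIo : IsOpen I) (hIc : I.OrdConnected) {s t : ℝ}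
    (hs : s ∈ I) (ht : t ∈ I) : ∃ δ > 0, Icc (s - δ) (t + δ) ⊆ I := by
  obtain ⟨ε₁, h1, hs'⟩ := Metric.isOpen_iff.1 hIo s hs
  obtain ⟨ε₂, h2, ht'⟩ := Metric.isOpen_iff.1 hIo t ht
  have hm : 0 < min ε₁ ε₂ := lt_min h1 h2
  refine ⟨min ε₁ ε₂ / 2, by positivity, hIc.out (hs' ?_) (ht' ?_)⟩
  · rw [Metric.mem_ball, Real.dist_eq, sub_sub_cancel_left, abs_neg, abs_of_pos (by positivity)]
    linarith [min_le_left ε₁ ε₂]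
  · rw [Metric.mem_ball, Real.dist_eq, add_sub_cancel_left, abs_of_pos (by positivity)]
    linarith [min_le_right ε₁ ε₂]

lemma ae_fst_ne (s : ℝ) : ∀ᵐ z : ℝ × E n, z.1 ≠ s := by
  have : ∀ᵐ r : ℝ, r ≠ s := by simp [ae_iff]
  exact Measure.quasiMeasurePreserving_fst.ae this

lemma eventually_tsupport_ramp_subset {I : Set ℝ} (hIo : IsOpen I) (hIc : I.OrdConnected)
    {s t : ℝ} (hs : s ∈ I) (ht : t ∈ I) (hst : s ≤ t) :
    ∀ᶠ k in atTop, tsupport (ramp k s t) ⊆ I := by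
  obtain ⟨δ, hδ, hI⟩ := exists_Icc_subset hIo hIc hs ht
  filter_upwards [eventually_two_div_lt hδ] with k hk
  exact (tsupport_ramp_subset k hst).trans ((Icc_subset_Icc (by linarith) (by linarith)).trans hI)

lemma integrable_ramp_mul {I : Set ℝ} {H : ℝ × E n → ℝ}
    (hH : ∀ a b, Icc a b ⊆ I → IntegrableOn H (Icc a b ×ˢ univ)) {s t : ℝ} (hst : s ≤ t) {k : ℕ}
    (hk : Icc (s - 2 / ((k : ℝ) + 1)) (t + 2 / ((k : ℝ) + 1)) ⊆ I) :
    Integrable (fun z => ramp k s t z.1 * H z) := by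
  have h1 : IntegrableOn (fun z => ramp k s t z.1 * H z) _ := (hH _ _ hk).bdd_mul (c := 1)
    ((contDiff_ramp k s t).continuous.comp continuous_fst).aestronglyMeasurable
    (.of_forall fun z => by
      rw [Real.norm_of_nonneg (ramp_nonneg k hst _)]
      exact ramp_le_one k hst _)
  rw [← integrableOn_univ]
  refine IntegrableOn.of_forall_sdiff_eq_zero h1 .univ fun z hz => ?_
  rw [ramp_eq_zero hst fun h => hz.2 ⟨h, mem_univ _⟩, zero_mul]

/-- Dominated convergence: from some index on, all cutoffs live in one interval [s − δ, t + δ] ⊆ I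
and take values in [0, 1], so |H| on that strip is a majorant. -/
lemma tendsto_integral_ramp_mul {I : Set ℝ} {H : ℝ × E n → ℝ} (hIo : IsOpen I)
    (hIc : I.OrdConnected) (hH : ∀ a b, Icc a b ⊆ I → IntegrableOn H (Icc a b ×ˢ univ))
    {s t : ℝ} (hs : s ∈ I) (ht : t ∈ I) (hst : s ≤ t) :
    Tendsto (fun k => ∫ z, ramp k s t z.1 * H z) atTop (𝓝 (∫ z in Icc s t ×ˢ univ, H z)) := by
  obtain ⟨δ, hδ, hI⟩ := exists_Icc_subset hIo hIc hs ht
  have hsub : ∀ᶠ k : ℕ in atTop,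
      Icc (s - 2 / ((k : ℝ) + 1)) (t + 2 / ((k : ℝ) + 1)) ⊆ Icc (s - δ) (t + δ) := by
    filter_upwards [eventually_two_div_lt hδ] with k hk
    exact Icc_subset_Icc (by linarith) (by linarith)
  have hm : MeasurableSet (Icc s t ×ˢ (univ : Set (E n))) := measurableSet_Icc.prod .univ
  have hm' : MeasurableSet (Icc (s - δ) (t + δ) ×ˢ (univ : Set (E n))) :=
    measurableSet_Icc.prod .univ
  rw [← integral_indicator hm]
  refine tendsto_integral_filter_of_dominated_convergence
    ((Icc (s - δ) (t + δ) ×ˢ univ).indicator fun z => ‖H z‖) ?_ ?_ ?_ ?_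
  · filter_upwards [hsub] with k hk
    exact (integrable_ramp_mul hH hst (hk.trans hI)).aestronglyMeasurable
  · filter_upwards [hsub] with k hk
    refine .of_forall fun z => ?_
    by_cases hz : z ∈ Icc (s - δ) (t + δ) ×ˢ (univ : Set (E n))
    · rw [indicator_of_mem hz, norm_mul, Real.norm_of_nonneg (ramp_nonneg k hst _)]
      exact mul_le_of_le_one_left (norm_nonneg _) (ramp_le_one k hst _)
    · rw [indicator_of_notMem hz, ramp_eq_zero hst fun h => hz ⟨hk h, mem_univ _⟩]
      simp
  · exact (integrable_indicator_iff hm').2 (hH _ _ hI).norm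
  · filter_upwards [ae_fst_ne s, ae_fst_ne t] with z hzs hzt
    have := (tendsto_ramp hst hzs hzt).mul_const (H z)
    convert this using 2
    by_cases hz : z.1 ∈ Icc s t
    · rw [indicator_of_mem hz, indicator_of_mem (show z ∈ Icc s t ×ˢ univ from ⟨hz, mem_univ _⟩), one_mul]
    · rw [indicator_of_notMem hz, indicator_of_notMem fun h => hz h.1, zero_mul]

lemma integrable_bounded_mul {W : ℝ × E n → ℝ} {C : ℝ} (hW : AEStronglyMeasurable W)
    (hC : ∀ z, |W z| ≤ C) {η : ℝ → ℝ} (hη : Integrable η) {k : E n → ℝ} (hk : Integrable k)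
    (x : E n) : Integrable (fun z : ℝ × E n => W z * (η z.1 * k (z.2 - x))) :=
  (hη.mul_prod (hk.comp_sub_right x)).bdd_mul hW (.of_forall hC)

lemma integral_bounded_mul {W : ℝ × E n → ℝ} {C : ℝ} (hW : AEStronglyMeasurable W)
    (hC : ∀ z, |W z| ≤ C) {η : ℝ → ℝ} (hη : Integrable η) {k : E n → ℝ} (hk : Integrable k)
    (x : E n) :
    ∫ z : ℝ × E n, W z * (η z.1 * k (z.2 - x)) = ∫ t, η t * moll k (fun y => W (t, y)) x := by
  have h := integrable_bounded_mul hW hC hη hk x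
  rw [Measure.volume_eq_prod] at h ⊢
  rw [integral_prod _ h]
  congr 1; ext t
  rw [moll_eq, ← integral_const_mul]
  congr 1; ext y
  ring

lemma aestronglyMeasurable_moll {W : ℝ × E n → ℝ} (hW : AEStronglyMeasurable W) {k : E n → ℝ}
    (hk : Continuous k) (x : E n) :
    AEStronglyMeasurable (fun t => moll k (fun y => W (t, y)) x) := by
  simp only [moll_eq]
  have : AEStronglyMeasurable (fun z : ℝ × E n => W z * k (z.2 - x)) (volume.prod volume) :=
    hW.mul (by fun_prop)
  exact this.integral_prod_right'

lemma locallyIntegrable_moll {W : ℝ × E n → ℝ} {C : ℝ} (hW : AEStronglyMeasurable W)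
    (hC : ∀ z, |W z| ≤ C) {k : E n → ℝ} (hk : Continuous k) (hki : Integrable k) (x : E n) :
    LocallyIntegrable (fun t => moll k (fun y => W (t, y)) x) := by
  rw [locallyIntegrable_iff]
  intro K hK
  exact Measure.integrableOn_of_bounded hK.measure_lt_top.ne (aestronglyMeasurable_moll hW hk x)
    (.of_forall fun t => abs_moll_le hki (fun y => hC (t, y)) x)

end SpaceTime

/-! ### Momentum balance and incompressibility at individual times. -/

section Solution

open Filter Topology

variable {n : ℕ}

/-- A weak solution of the Euler equations that is bounded and Hölder continuous at all times. -/
structure BoundedSolution (b : Module.Basis (Fin n) ℝ (E n)) (I : Set ℝ) (α M : ℝ)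
    (w : ℝ → E n → E n) (p : ℝ → E n → ℝ) : Prop where
  nonneg : 0 ≤ M
  periodic : ∀ t, IsPeriodic b (w t)
  bound : ∀ t x, ‖w t x‖ ≤ M
  holder : ∀ t x y, ‖w t x - w t y‖ ≤ M * ‖x - y‖ ^ α
  measurable : AEStronglyMeasurable (fun z : ℝ × E n => w z.1 z.2)
  pressure_periodic : PeriodicOn b I p
  pressure_integrable : LocallyIntegrableOn (fun z : ℝ × E n => p z.1 z.2) (I ×ˢ univ)
  momentum : ∀ φ : ℝ × E n → ℝ, IsTestFunction I φ → ∀ l : Fin n,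
    ∫ z in I ×ˢ univ, (w z.1 z.2 l * dt φ z + (∑ j, w z.1 z.2 j * w z.1 z.2 l * dx j φ z)
      + p z.1 z.2 * dx l φ z) = 0
  incompressible : ∀ φ : ℝ × E n → ℝ, IsTestFunction I φ →
    ∫ z in I ×ˢ univ, (∑ j, w z.1 z.2 j * dx j φ z) = 0

namespace BoundedSolution

variable {b : Module.Basis (Fin n) ℝ (E n)} {I : Set ℝ} {α M : ℝ} {w : ℝ → E n → E n}
  {p : ℝ → E n → ℝ}

lemma abs_apply_le (h : BoundedSolution b I α M w p) (t : ℝ) (x : E n) (l : Fin n) :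
    |w t x l| ≤ M :=
  (PiLp.norm_apply_le (w t x) l).trans (h.bound t x)

lemma abs_mul_le (h : BoundedSolution b I α M w p) (t : ℝ) (x : E n) (j l : Fin n) :
    |w t x j * w t x l| ≤ M * M := by
  rw [abs_mul]
  exact mul_le_mul (h.abs_apply_le t x j) (h.abs_apply_le t x l) (abs_nonneg _) h.nonneg

lemma measurable_apply (h : BoundedSolution b I α M w p) (l : Fin n) :
    AEStronglyMeasurable (fun z : ℝ × E n => w z.1 z.2 l) :=
  (EuclideanSpace.proj (𝕜 := ℝ) l).continuous.comp_aestronglyMeasurable h.measurable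

lemma continuous (h : BoundedSolution b I α M w p) (hα : 0 < α) (t : ℝ) : Continuous (w t) := by
  rw [continuous_iff_continuousAt]
  intro x
  rw [ContinuousAt, tendsto_iff_norm_sub_tendsto_zero]
  have h1 : Continuous fun y : E n => M * ‖y - x‖ ^ α :=
    continuous_const.mul ((by fun_prop : Continuous fun y : E n => ‖y - x‖).rpow_const
      fun _ => .inr hα.le)
  have h2 := h1.tendsto x
  simp only [sub_self, norm_zero, Real.zero_rpow hα.ne', mul_zero] at h2
  exact squeeze_zero (fun _ => norm_nonneg _) (fun y => h.holder t y x) h2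

lemma continuous_apply (h : BoundedSolution b I α M w p) (hα : 0 < α) (t : ℝ) (l : Fin n) :
    Continuous (fun y => w t y l) :=
  (EuclideanSpace.proj (𝕜 := ℝ) l).continuous.comp (h.continuous hα t)

/-- The momentum balance between two Lebesgue points of the mollified velocity. -/
lemma moll_sub_moll (h : BoundedSolution b I α M w p) (hIo : IsOpen I) (hIc : I.OrdConnected)
    {φ : E n → ℝ} (hφ : ContDiff ℝ ∞ φ) (hφc : HasCompactSupport φ) (x : E n) (l : Fin n)
    {s t : ℝ} (hs : s ∈ I) (ht : t ∈ I) (hst : s < t)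
    (hs' : Tendsto (fun k => ∫ u, bumpKernel k (u - s) * moll φ (fun y => w u y l) x) atTop
      (𝓝 (moll φ (fun y => w s y l) x)))
    (ht' : Tendsto (fun k => ∫ u, bumpKernel k (u - t) * moll φ (fun y => w u y l) x) atTop
      (𝓝 (moll φ (fun y => w t y l) x))) :
    moll φ (fun y => w t y l) x - moll φ (fun y => w s y l) x =
      (∑ j, moll (pd j φ) (fun y => ∫ r in Icc s t, w r y j * w r y l) x) +
        moll (pd l φ) (fun y => ∫ r in Icc s t, p r y) x := by
  have hpc : ∀ j, Continuous (pd j φ) := fun j => (contDiff_pd hφ j).continuous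
  have hps : ∀ j, HasCompactSupport (pd j φ) := hasCompactSupport_pd hφc
  have hφi : Integrable φ := hφ.continuous.integrable_of_hasCompactSupport hφc
  have hS1 : ∀ j, StripIntegrable I (fun z : ℝ × E n => w z.1 z.2 j * w z.1 z.2 l) := fun j =>
    .of_bounded ((h.measurable_apply j).mul (h.measurable_apply l)) fun z => h.abs_mul_le _ _ _ _
  have hS2 : StripIntegrable I (fun z : ℝ × E n => p z.1 z.2) :=
    .of_locallyIntegrableOn h.pressure_integrable
  set H : ℝ × E n → ℝ := fun z => (∑ j, w z.1 z.2 j * w z.1 z.2 l * pd j φ (z.2 - x)) +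
    p z.1 z.2 * pd l φ (z.2 - x) with hH
  have hHi : ∀ a b, Icc a b ⊆ I → IntegrableOn H (Icc a b ×ˢ univ) := fun a b hab =>
    (integrable_finsetSum _ fun j _ => (hS1 j).integrableOn_mul (hpc j) (hps j) x hab).add
      (hS2.integrableOn_mul (hpc l) (hps l) x hab)
  have hlim := tendsto_integral_ramp_mul hIo hIc hHi hs ht hst.le
  -- The weak momentum equation for the test function `ramp k s t r * φ (y - x)`, with the
  -- time-derivative term written as two time averages.
  have hzero : ∀ᶠ k in atTop, (∫ u, bumpKernel k (u - s) * moll φ (fun y => w u y l) x) -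
      (∫ u, bumpKernel k (u - t) * moll φ (fun y => w u y l) x) +
        ∫ z, ramp k s t z.1 * H z = 0 := by
    obtain ⟨δ, hδ, hδI⟩ := exists_Icc_subset hIo hIc hs ht
    filter_upwards [eventually_tsupport_ramp_subset hIo hIc hs ht hst.le,
      eventually_two_div_lt hδ] with k hk hkδ
    have hk' : Icc (s - 2 / ((k : ℝ) + 1)) (t + 2 / ((k : ℝ) + 1)) ⊆ I :=
      (Icc_subset_Icc (by linarith) (by linarith)).trans hδI
    have hη := contDiff_ramp k s t
    have htest := isTestFunction_mul hη (hasCompactSupport_ramp k hst.le) hk hφ hφc x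
    have hm := h.momentum _ htest l
    simp only [dt_mul_test hη hφ, dx_mul_test hη hφ] at hm
    have hi := integrable_ramp_mul hHi hst.le hk'
    have hb : ∀ τ, Integrable (fun u => bumpKernel k (u - τ)) := fun τ =>
      (integrable_bumpKernel k).comp_sub_right τ
    have hd : Integrable (deriv (ramp k s t)) := by
      rw [deriv_ramp]; exact (hb s).sub (hb t)
    have e1 := integral_bounded_mul (h.measurable_apply l) (fun z => h.abs_apply_le _ _ l)
      hd hφi x
    have e2 : ∫ τ, deriv (ramp k s t) τ * moll φ (fun y => w τ y l) x =
        (∫ u, bumpKernel k (u - s) * moll φ (fun y => w u y l) x) -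
          ∫ u, bumpKernel k (u - t) * moll φ (fun y => w u y l) x := by
      have hbm : ∀ τ, Integrable
          (fun u => bumpKernel k (u - τ) * moll φ (fun y => w u y l) x) := fun τ =>
        (hb τ).mul_bdd
          (aestronglyMeasurable_moll (h.measurable_apply l) hφ.continuous x)
          (.of_forall fun u => abs_moll_le hφi (fun y => h.abs_apply_le u y l) x)
      rw [← integral_sub (hbm s) (hbm t), deriv_ramp]
      simp only [sub_mul]
    rw [← e2, ← e1, ← integral_add
      (integrable_bounded_mul (h.measurable_apply l) (fun z => h.abs_apply_le _ _ l) hd hφi x) hi]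
    rw [setIntegral_eq_integral_of_forall_compl_eq_zero] at hm
    · rw [← hm]
      congr 1; ext z
      simp only [hH, mul_add, Finset.mul_sum, add_assoc]
      congr 2
      · exact Finset.sum_congr rfl fun j _ => by ring
      · ring
    -- Outside I the cutoff and its derivative both vanish, so the integral over the strip is an
    -- integral over all of space-time.
    · intro z hz
      have hz1 : z.1 ∉ tsupport (ramp k s t) := fun h' => hz ⟨hk h', mem_univ _⟩
      have hz2 : deriv (ramp k s t) z.1 = 0 := by
        by_contra h'
        exact hz1 (support_deriv_subset h')
      simp [image_eq_zero_of_notMem_tsupport hz1, hz2]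
  have hlim2 := ((hs'.sub ht').add hlim).congr' hzero
  have hfin := tendsto_nhds_unique hlim2 tendsto_const_nhds
  have hI : Icc s t ⊆ I := hIc.out hs ht
  have hcomp : ∫ z in Icc s t ×ˢ univ, H z =
      (∑ j, moll (pd j φ) (fun y => ∫ r in Icc s t, w r y j * w r y l) x) +
        moll (pd l φ) (fun y => ∫ r in Icc s t, p r y) x := by
    rw [hH, integral_add (integrable_finsetSum _ fun j _ =>
      (hS1 j).integrableOn_mul (hpc j) (hps j) x hI) (hS2.integrableOn_mul (hpc l) (hps l) x hI),
      integral_finsetSum _ fun j _ => (hS1 j).integrableOn_mul (hpc j) (hps j) x hI,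
      hS2.integral_mul (hpc l) (hps l) x hI]
    simp only [fun j => (hS1 j).integral_mul (hpc j) (hps j) x hI]
  linarith

/-- The mollified momentum balance holds at all points between almost all pairs of times. -/
lemma exists_momentum_balance (h : BoundedSolution b I α M w p) (hα : 0 < α) (hIo : IsOpen I)
    (hIc : I.OrdConnected) {φ : E n → ℝ} (hφ : ContDiff ℝ ∞ φ) (hφc : HasCompactSupport φ) :
    ∃ T : Set ℝ, (∀ᵐ t, t ∈ T) ∧ ∀ s t, s ∈ T → t ∈ T → s ∈ I → t ∈ I → s < t → ∀ l x,
      moll φ (fun y => w t y l) x - moll φ (fun y => w s y l) x =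
        (∑ j, moll (pd j φ) (fun y => ∫ r in Icc s t, w r y j * w r y l) x) +
          moll (pd l φ) (fun y => ∫ r in Icc s t, p r y) x := by
  have hφi : Integrable φ := hφ.continuous.integrable_of_hasCompactSupport hφc
  -- Common Lebesgue points for a countable dense set of x and all components. Both sides of the
  -- balance are continuous in x, so the exceptional null set does not depend on x.
  refine ⟨{t | ∀ (i : ℕ) (l : Fin n), Tendsto (fun k => ∫ u, bumpKernel k (u - t) *
    moll φ (fun y => w u y l) (TopologicalSpace.denseSeq (E n) i)) atTop
      (𝓝 (moll φ (fun y => w t y l) (TopologicalSpace.denseSeq (E n) i)))}, ?_, ?_⟩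
  · refine ae_all_iff.2 fun i => ae_all_iff.2 fun l => ?_
    exact ae_tendsto_integral_bumpKernel (locallyIntegrable_moll (h.measurable_apply l)
      (fun z => h.abs_apply_le _ _ l) hφ.continuous hφi _)
  · intro s t hs ht hsI htI hst l
    have hI : Icc s t ⊆ I := hIc.out hsI htI
    refine congrFun (Continuous.ext_on (TopologicalSpace.denseRange_denseSeq (E n)) ?_ ?_ ?_)
    · exact (continuous_moll hφ.continuous hφc (h.continuous_apply hα t l).locallyIntegrable).sub
        (continuous_moll hφ.continuous hφc (h.continuous_apply hα s l).locallyIntegrable)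
    · refine (continuous_finsetSum _ fun j _ => continuous_moll (contDiff_pd hφ j).continuous
        (hasCompactSupport_pd hφc j) ?_).add (continuous_moll (contDiff_pd hφ l).continuous
        (hasCompactSupport_pd hφc l) ?_)
      · exact StripIntegrable.locallyIntegrable (I := I)
          (.of_bounded ((h.measurable_apply j).mul (h.measurable_apply l))
            fun z => h.abs_mul_le _ _ _ _) hI
      · exact (StripIntegrable.of_locallyIntegrableOn h.pressure_integrable).locallyIntegrable hI
    · rintro _ ⟨i, rfl⟩
      exact h.moll_sub_moll hIo hIc hφ hφc _ l hsI htI hst (hs i l) (ht i l)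

/-- The velocity is divergence free at almost all times. -/
lemma ae_sum_moll_pd_eq_zero (h : BoundedSolution b I α M w p) (hα : 0 < α) (hIo : IsOpen I)
    {φ : E n → ℝ} (hφ : ContDiff ℝ ∞ φ) (hφc : HasCompactSupport φ) :
    ∀ᵐ t, t ∈ I → ∀ x, ∑ j, moll (pd j φ) (fun y => w t y j) x = 0 := by
  have hpc : ∀ j, Continuous (pd j φ) := fun j => (contDiff_pd hφ j).continuous
  have hps : ∀ j, HasCompactSupport (pd j φ) := hasCompactSupport_pd hφc
  have hpi : ∀ j, Integrable (pd j φ) := fun j =>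
    (hpc j).integrable_of_hasCompactSupport (hps j)
  have key : ∀ i, ∀ᵐ t, t ∈ I →
      ∑ j, moll (pd j φ) (fun y => w t y j) (TopologicalSpace.denseSeq (E n) i) = 0 := by
    intro i
    set x := TopologicalSpace.denseSeq (E n) i
    have hli : LocallyIntegrable (fun t => ∑ j, moll (pd j φ) (fun y => w t y j) x) := by
      refine locallyIntegrable_finsetSum _ fun j _ => ?_
      exact locallyIntegrable_moll (h.measurable_apply j) (fun z => h.abs_apply_le _ _ j)
        (hpc j) (hpi j) x
    -- The fundamental lemma of the calculus of variations in time, at a fixed point x of the dense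
    -- sequence.
    refine hIo.ae_eq_zero_of_integral_contDiff_smul_eq_zero (hli.locallyIntegrableOn _) ?_
    intro η hη hηc hηI
    have hηi : Integrable η := hη.continuous.integrable_of_hasCompactSupport hηc
    have hm := h.incompressible _ (isTestFunction_mul hη hηc hηI hφ hφc x)
    simp only [dx_mul_test hη hφ] at hm
    rw [setIntegral_eq_integral_of_forall_compl_eq_zero, integral_finsetSum] at hm
    · simp only [fun j => integral_bounded_mul (h.measurable_apply j)
        (fun z => h.abs_apply_le _ _ j) hηi (hpi j) x] at hm
      rw [← hm, ← integral_finsetSum]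
      · simp only [smul_eq_mul, Finset.mul_sum]
      · intro j _
        exact hηi.mul_bdd (aestronglyMeasurable_moll (h.measurable_apply j) (hpc j) x)
          (.of_forall fun u => abs_moll_le (hpi j) (fun y => h.abs_apply_le u y j) x)
    · exact fun j _ => integrable_bounded_mul (h.measurable_apply j)
        (fun z => h.abs_apply_le _ _ j) hηi (hpi j) x
    · intro z hz
      have hz1 : z.1 ∉ tsupport η := fun h' => hz ⟨hηI h', mem_univ _⟩
      simp [image_eq_zero_of_notMem_tsupport hz1]
  filter_upwards [ae_all_iff.2 key] with t ht htI
  refine congrFun (Continuous.ext_on (TopologicalSpace.denseRange_denseSeq (E n)) ?_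
    continuous_const ?_)
  · exact continuous_finsetSum _ fun j _ =>
      continuous_moll (hpc j) (hps j) (h.continuous_apply hα t j).locallyIntegrable
  · rintro _ ⟨i, rfl⟩
    exact ht i htI

end BoundedSolution

end Solution

/-! ### The rescaled mollification kernel and its moments. -/

section Kernel

variable {n : ℕ}

/-- A fixed smooth mollification kernel. -/
noncomputable def baseKernel (n : ℕ) : E n → ℝ :=
  ContDiffBump.normed (⟨1, 2, one_pos, one_lt_two⟩ : ContDiffBump (0 : E n)) volume

lemma contDiff_baseKernel : ContDiff ℝ ∞ (baseKernel n) := ContDiffBump.contDiff_normed _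

lemma hasCompactSupport_baseKernel : HasCompactSupport (baseKernel n) :=
  ContDiffBump.hasCompactSupport_normed _

lemma baseKernel_neg (z : E n) : baseKernel n (-z) = baseKernel n z :=
  ContDiffBump.normed_neg _ z

/-- The mollification kernel at length scale `ε`. -/
noncomputable def kernel (n : ℕ) (ε : ℝ) (z : E n) : ℝ := (ε ^ n)⁻¹ * baseKernel n (ε⁻¹ • z)

lemma contDiff_kernel (ε : ℝ) : ContDiff ℝ ∞ (kernel n ε) :=
  contDiff_const.mul (contDiff_baseKernel.comp (contDiff_const_smul ε⁻¹))

lemma hasCompactSupport_kernel {ε : ℝ} (hε : 0 < ε) : HasCompactSupport (kernel n ε) :=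
  (hasCompactSupport_baseKernel.comp_smul (inv_ne_zero hε.ne')).mul_left

lemma kernel_neg (ε : ℝ) (z : E n) : kernel n ε (-z) = kernel n ε z := by
  simp [kernel, smul_neg, baseKernel_neg]

lemma integral_kernel_mul {ε : ℝ} (hε : 0 < ε) (g : E n → ℝ) :
    ∫ z, (ε ^ n)⁻¹ * g (ε⁻¹ • z) = ∫ z, g z := by
  rw [integral_const_mul, Measure.integral_comp_inv_smul volume g ε, finrank_euclideanSpace_fin,
    abs_of_pos (by positivity), smul_eq_mul, inv_mul_cancel_left₀ (by positivity)]

lemma integral_kernel {ε : ℝ} (hε : 0 < ε) : ∫ z, kernel n ε z = 1 :=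
  (integral_kernel_mul hε _).trans (ContDiffBump.integral_normed _)

lemma pd_kernel (ε : ℝ) (j : Fin n) (z : E n) :
    pd j (kernel n ε) z = (ε ^ n)⁻¹ * (ε⁻¹ * pd j (baseKernel n) (ε⁻¹ • z)) := by
  have h1 : HasFDerivAt (fun z : E n => ε⁻¹ • z) (ε⁻¹ • ContinuousLinearMap.id ℝ (E n)) z :=
    (hasFDerivAt_id z).const_smul ε⁻¹
  have h2 := ((contDiff_baseKernel (n := n)).differentiable (by simp) (ε⁻¹ • z)).hasFDerivAt
  have h3 : HasFDerivAt (kernel n ε) _ z := (h2.comp z h1).const_mul (ε ^ n)⁻¹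
  rw [pd, h3.fderiv]
  simp [pd]

lemma pd_neg_of_even {φ : E n → ℝ} (hφs : ContDiff ℝ ∞ φ) (hφ : ∀ z, φ (-z) = φ z) (j : Fin n)
    (z : E n) : pd j φ (-z) = -pd j φ z := by
  have h1 : HasFDerivAt (fun z : E n => -z) (-ContinuousLinearMap.id ℝ (E n)) z :=
    (hasFDerivAt_id z).neg
  have h2 := (hφs.differentiable (by simp) (-z)).hasFDerivAt.comp z h1
  have h3 : φ ∘ (fun z : E n => -z) = φ := funext hφ
  rw [h3] at h2
  rw [pd, pd, h2.fderiv]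
  simp

lemma integral_kernel_moment {ε : ℝ} (hε : 0 < ε) (β : ℝ) :
    ∫ z, |kernel n ε z| * ‖z‖ ^ β = ε ^ β * ∫ z, |baseKernel n z| * ‖z‖ ^ β := by
  rw [← integral_const_mul, ← integral_kernel_mul hε (fun z => ε ^ β * _)]
  congr 1; ext z
  rw [kernel, norm_smul, Real.mul_rpow (norm_nonneg _) (norm_nonneg _), norm_inv,
    Real.norm_of_nonneg hε.le, Real.inv_rpow hε.le, abs_mul, abs_of_pos (inv_pos.2 (pow_pos hε n))]
  field_simp

/-- Differentiating the rescaled kernel costs one factor ε⁻¹. With β = 3α this is the source of the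
flux exponent 3α − 1. -/
lemma integral_pd_kernel_moment {ε : ℝ} (hε : 0 < ε) (β : ℝ) (j : Fin n) :
    ∫ z, |pd j (kernel n ε) z| * ‖z‖ ^ β =
      ε ^ (β - 1) * ∫ z, |pd j (baseKernel n) z| * ‖z‖ ^ β := by
  rw [← integral_const_mul, ← integral_kernel_mul hε (fun z => ε ^ (β - 1) * _)]
  congr 1; ext z
  rw [pd_kernel, norm_smul, Real.mul_rpow (norm_nonneg _) (norm_nonneg _), norm_inv,
    Real.norm_of_nonneg hε.le, Real.inv_rpow hε.le, abs_mul, abs_mul, Real.rpow_sub_one hε.ne',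
    abs_of_pos (inv_pos.2 (pow_pos hε n)), abs_of_pos (inv_pos.2 hε)]
  field_simp

end Kernel

/-! ### Subdivision in time. -/

section Telescoping

/-- An increment bound whose error is a length times an integral over the interval improves
to a Lipschitz bound. -/
lemma abs_sub_le_of_increment_bound {I T : Set ℝ} (hIc : I.OrdConnected) (hT : ∀ᵐ t, t ∈ T)
    {f γ : ℝ → ℝ} {K C : ℝ} (hC : 0 ≤ C)
    (hγi : ∀ s t, Icc s t ⊆ I → IntegrableOn γ (Icc s t))
    (hf : ∀ s t, s ∈ T → t ∈ T → s ∈ I → t ∈ I → s < t →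
      |f t - f s| ≤ (t - s) * (K + C * ∫ r in Icc s t, γ r))
    {s t : ℝ} (hs : s ∈ T) (ht : t ∈ T) (hsI : s ∈ I) (htI : t ∈ I) (hst : s < t) :
    |f t - f s| ≤ K * (t - s) := by
  have hI : Icc s t ⊆ I := hIc.out hsI htI
  have hint : ∀ a b, s ≤ a → b ≤ t → IntegrableOn γ (Icc a b) := fun a b ha hb =>
    hγi a b ((Icc_subset_Icc ha hb).trans hI)
  set F : ℝ → ℝ := fun x => ∫ r in s..x, γ r with hF
  have hFc : ContinuousOn F (Icc s t) := by
    have := intervalIntegral.continuousOn_primitive_interval (μ := volume) (f := γ) (a := s) (b := t)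
      (by rw [uIcc_of_le hst.le]; exact hint s t le_rfl le_rfl)
    rwa [uIcc_of_le hst.le] at this
  have hFi : ∀ a b, s ≤ a → a ≤ b → b ≤ t → ∫ r in Icc a b, γ r = F b - F a := by
    intro a b ha hab hb
    have h1 : ∀ x, s ≤ x → x ≤ t → IntervalIntegrable γ volume s x := fun x hx hxt =>
      (intervalIntegrable_iff_integrableOn_Icc_of_le hx).2 (hint s x le_rfl hxt)
    simp only [hF]
    rw [intervalIntegral.integral_interval_sub_left (h1 b (ha.trans hab) hb)
      (h1 a ha (hab.trans hb)), intervalIntegral.integral_of_le hab, integral_Icc_eq_integral_Ioc]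
  have hFu := isCompact_Icc.uniformContinuousOn_of_continuous hFc
  refine le_of_forall_pos_le_add fun θ hθ => ?_
  -- Chosen so that C θ' (t − s) ≤ θ; the summand 1 avoids division by zero when C = 0.
  set θ' := θ / ((t - s) * (C + 1)) with hθ'
  have hts : 0 < t - s := sub_pos.2 hst
  have hθ'pos : 0 < θ' := by positivity
  obtain ⟨δ, hδ, hδF⟩ := Metric.uniformContinuousOn_iff.1 hFu θ' hθ'pos
  have hsmall : ∀ a b, a ∈ T → b ∈ T → s ≤ a → a < b → b ≤ t → b - a < δ →
      |f b - f a| ≤ (K + C * θ') * (b - a) := by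
    intro a b ha hb hsa hab hbt hd
    have h1 := hf a b ha hb (hI ⟨hsa, hab.le.trans hbt⟩) (hI ⟨hsa.trans hab.le, hbt⟩) hab
    rw [hFi a b hsa hab.le hbt] at h1
    have h2 := hδF b ⟨hsa.trans hab.le, hbt⟩ a ⟨hsa, hab.le.trans hbt⟩
      (by rw [Real.dist_eq, abs_of_pos (sub_pos.2 hab)]; exact hd)
    rw [Real.dist_eq] at h2
    refine h1.trans ?_
    rw [mul_comm]
    gcongr
    exact (le_abs_self _).trans h2.le
  have hpick : ∀ a b : ℝ, a < b → ∃ m ∈ T, a < m ∧ m < b := by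
    intro a b hab
    by_contra! hcon
    have h0 : volume (Ioo a b) = 0 :=
      measure_mono_null (t := {m | ¬ m ∈ T})
        (fun m hm hmT => absurd hm.2 (not_lt.2 (hcon m hmT hm.1))) hT
    rw [Real.volume_Ioo, ENNReal.ofReal_eq_zero] at h0
    linarith
  -- Induction on a budget of half-steps. Each intermediate time is taken in T at distance between
  -- δ/2 and δ: short enough for `hsmall`, long enough to use up one unit of the budget.
  have hmain : ∀ N : ℕ, ∀ a, a ∈ T → s ≤ a → a < t → t - a < N * (δ / 2) →
      |f t - f a| ≤ (K + C * θ') * (t - a) := by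
    intro N
    induction N with
    | zero => intro a _ _ hat h; simp at h; linarith
    | succ N ih =>
      intro a ha hsa hat hN
      by_cases hlt : t - a < δ
      · exact hsmall a t ha ht hsa hat le_rfl hlt
      · obtain ⟨m, hm, hm1, hm2⟩ := hpick (a + δ / 2) (a + δ) (by linarith)
        push_cast at hN
        have h1 := ih m hm (by linarith) (by linarith) (by linarith)
        have h2 := hsmall a m ha hm hsa (by linarith) (by linarith) (by linarith)
        calc |f t - f a| = |(f t - f m) + (f m - f a)| := by ring_nf
          _ ≤ _ := (abs_add_le _ _).trans (add_le_add h1 h2)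
          _ = _ := by ring
  obtain ⟨N, hN⟩ := exists_nat_gt ((t - s) / (δ / 2))
  have h := hmain N s hs le_rfl hst (by rwa [div_lt_iff₀ (by positivity)] at hN)
  refine h.trans ?_
  have : C * θ' * (t - s) ≤ θ := by
    rw [hθ']
    have : C * (θ / ((t - s) * (C + 1))) * (t - s) = θ * (C / (C + 1)) := by
      field_simp
    rw [this]
    exact mul_le_of_le_one_right hθ.le ((div_le_one (by positivity)).2 (by linarith))
  linarith

end Telescoping

lemma integral_linear_combination {X : Type*} [MeasurableSpace X] {μ : Measure X}
    {f₁ f₂ f₃ f₄ : X → ℝ} (h₁ : Integrable f₁ μ) (h₂ : Integrable f₂ μ) (h₃ : Integrable f₃ μ)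
    (h₄ : Integrable f₄ μ) (c₁ c₂ c₃ c₄ : ℝ) :
    ∫ x, (c₁ * f₁ x + c₂ * f₂ x + c₃ * f₃ x + c₄ * f₄ x) ∂μ =
      c₁ * ∫ x, f₁ x ∂μ + c₂ * ∫ x, f₂ x ∂μ + c₃ * ∫ x, f₃ x ∂μ + c₄ * ∫ x, f₄ x ∂μ := by
  have j₁ := h₁.const_mul c₁
  have j₂ := h₂.const_mul c₂
  have j₃ := h₃.const_mul c₃
  have j₄ := h₄.const_mul c₄
  have j₁₂ : Integrable (fun x => c₁ * f₁ x + c₂ * f₂ x) μ := j₁.add j₂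
  have j₁₂₃ : Integrable (fun x => c₁ * f₁ x + c₂ * f₂ x + c₃ * f₃ x) μ := j₁₂.add j₃
  rw [integral_add j₁₂₃ j₄, integral_add j₁₂ j₃, integral_add j₁ j₂]
  simp only [integral_const_mul]

/-! ### Increment identities on the torus. -/

section TorusFunctions

variable {n : ℕ} {b : Module.Basis (Fin n) ℝ (E n)}

/-- Bounded continuous functions on the torus. -/
structure TorusFn (b : Module.Basis (Fin n) ℝ (E n)) (f : E n → ℝ) : Prop where
  continuous : Continuous f
  periodic : IsPeriodic b f
  bounded : ∃ C, ∀ x, |f x| ≤ C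

namespace TorusFn

variable {f g k : E n → ℝ}

lemma mul (hf : TorusFn b f) (hg : TorusFn b g) : TorusFn b (fun x => f x * g x) := by
  obtain ⟨C, hC⟩ := hf.bounded
  obtain ⟨C', hC'⟩ := hg.bounded
  refine ⟨hf.continuous.mul hg.continuous, hf.periodic.map₂ hg.periodic (· * ·), C * C', fun x => ?_⟩
  rw [abs_mul]
  exact mul_le_mul (hC x) (hC' x) (abs_nonneg _) ((abs_nonneg _).trans (hC x))

lemma add (hf : TorusFn b f) (hg : TorusFn b g) : TorusFn b (fun x => f x + g x) := by
  obtain ⟨C, hC⟩ := hf.bounded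
  obtain ⟨C', hC'⟩ := hg.bounded
  exact ⟨hf.continuous.add hg.continuous, hf.periodic.map₂ hg.periodic (· + ·), C + C',
    fun x => (abs_add_le _ _).trans (add_le_add (hC x) (hC' x))⟩

lemma comp_add (hf : TorusFn b f) (z : E n) : TorusFn b (fun x => f (x + z)) := by
  obtain ⟨C, hC⟩ := hf.bounded
  exact ⟨hf.continuous.comp (continuous_add_const z), hf.periodic.comp_add z, C, fun x => hC _⟩

lemma integrableOn (hf : TorusFn b f) : IntegrableOn f (ZSpan.fundamentalDomain b) :=
  integrableOn_cell hf.continuous.locallyIntegrable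

lemma integrable_pairing (hf : TorusFn b f) (hg : TorusFn b g) (hk : Integrable k) :
    Integrable (fun p : E n × E n => f p.1 * (g (p.1 + p.2) * k p.2))
      ((volume.restrict (ZSpan.fundamentalDomain b)).prod volume) := by
  obtain ⟨C, hC⟩ := hf.bounded
  exact integrable_pairing_left hf.continuous.aestronglyMeasurable hC
    hg.continuous.locallyIntegrable hg.periodic hk

lemma integral_mul_moll (hf : TorusFn b f) (hg : TorusFn b g) (hk : Integrable k) :
    ∫ x in ZSpan.fundamentalDomain b, f x * moll k g x = ∫ z, corr b f g z * k z :=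
  integral_mul_moll_of_integrable (hf.integrable_pairing hg hk)

lemma integrable_corr_mul (hf : TorusFn b f) (hg : TorusFn b g) (hk : Integrable k) :
    Integrable (fun z => corr b f g z * k z) := by
  have := (hf.integrable_pairing hg hk).integral_prod_right
  refine this.congr (.of_forall fun z => ?_)
  simp only [corr, ← integral_mul_const, mul_assoc]

lemma integral_mul_moll_even (hf : TorusFn b f) (hg : TorusFn b g) (hk : Integrable k)
    (hkn : ∀ z, k (-z) = k z) :
    ∫ x in ZSpan.fundamentalDomain b, f x * moll k g x =
      ∫ x in ZSpan.fundamentalDomain b, g x * moll k f x := by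
  obtain ⟨C, hC⟩ := hf.bounded
  rw [integral_mul_moll_swap hf.continuous.aestronglyMeasurable hC hf.periodic
    hg.continuous.locallyIntegrable hg.periodic hk]
  simp only [hkn]

/-- An odd kernel acts skew-symmetrically. The factor g is allowed to be merely locally integrable,
so that the time integrals of the pressure and of w⊗w are covered. -/
lemma integral_mul_moll_odd (hf : TorusFn b f) (hg : LocallyIntegrable g) (hgp : IsPeriodic b g)
    (hk : Integrable k) (hkn : ∀ z, k (-z) = -k z) :
    ∫ x in ZSpan.fundamentalDomain b, f x * moll k g x =
      -∫ x in ZSpan.fundamentalDomain b, g x * moll k f x := by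
  obtain ⟨C, hC⟩ := hf.bounded
  rw [integral_mul_moll_swap hf.continuous.aestronglyMeasurable hC hf.periodic hg hgp hk,
    ← integral_neg]
  simp only [hkn, moll, mul_neg, integral_neg]

/-- The pairing of a product with an odd kernel in terms of increments. -/
lemma integral_increments_mul (hf : TorusFn b f) (hg : TorusFn b g) (hk : Integrable k)
    (hkn : ∀ z, k (-z) = -k z) :
    ∫ z, (∫ x in ZSpan.fundamentalDomain b,
        (f (x + z) - f x) * (g (x + z) - g x) ^ 2) * k z =
      4 * (∫ x in ZSpan.fundamentalDomain b, f x * g x * moll k g x) +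
        2 * ∫ x in ZSpan.fundamentalDomain b, g x * g x * moll k f x := by
  have hfg := hf.mul hg
  have hgg := hg.mul hg
  have hfgg := hf.mul hgg
  -- Expanding the cube gives six terms; f g² at x + z and f g² at x have equal integrals and
  -- cancel, leaving four correlations.
  have h1 : ∀ z, ∫ x in ZSpan.fundamentalDomain b, (f (x + z) - f x) * (g (x + z) - g x) ^ 2 =
      -2 * corr b g (fun x => f x * g x) z + corr b (fun x => g x * g x) f z -
        corr b f (fun x => g x * g x) z + 2 * corr b (fun x => f x * g x) g z := by
    intro z
    have i1 := (hg.mul (hfg.comp_add z)).integrableOn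
    have i2 := (hgg.mul (hf.comp_add z)).integrableOn
    have i3 := (hf.mul (hgg.comp_add z)).integrableOn
    have i4 := (hfg.mul (hg.comp_add z)).integrableOn
    have i5 := hfgg.integrableOn
    have i6 := (hfgg.comp_add z).integrableOn
    have e := integral_cell_add hfgg.periodic z
    have c := integral_linear_combination i1 i2 i3 i4 (-2) 1 (-1) 2
    have hadd := integral_linear_combination
      (μ := volume.restrict (ZSpan.fundamentalDomain b))
      (f₁ := fun x => -2 * (g x * (f (x + z) * g (x + z))) + 1 * (g x * g x * f (x + z)) +
        -1 * (f x * (g (x + z) * g (x + z))) + 2 * (f x * g x * g (x + z)))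
      (f₂ := fun x => f (x + z) * (g (x + z) * g (x + z)))
      ((((i1.const_mul _).add (i2.const_mul _)).add (i3.const_mul _)).add (i4.const_mul _))
      i6 i5 i5 1 1 (-1) 0
    rw [c] at hadd
    simp only [corr]
    calc _ = _ := integral_congr_ae (.of_forall fun x => by ring)
      _ = _ := hadd
      _ = _ := by rw [e]; ring
  have j1 := hg.integrable_corr_mul hfg hk
  have j2 := hgg.integrable_corr_mul hf hk
  have j3 := hf.integrable_corr_mul hgg hk
  have j4 := hfg.integrable_corr_mul hg hk
  have e1 := hg.integral_mul_moll hfg hk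
  have e2 := hgg.integral_mul_moll hf hk
  have e3 := hf.integral_mul_moll hgg hk
  have e4 := hfg.integral_mul_moll hg hk
  -- Oddness of k identifies the four pairings in two pairs, which produces the coefficients 4 = 2 +
  -- 2 and 2 = 1 + 1.
  have o1 := hg.integral_mul_moll_odd hfg.continuous.locallyIntegrable hfg.periodic hk hkn
  have o3 := hf.integral_mul_moll_odd hgg.continuous.locallyIntegrable hgg.periodic hk hkn
  have c := integral_linear_combination j1 j2 j3 j4 (-2) 1 (-1) 2
  calc _ = _ := integral_congr_ae (.of_forall fun z => by simp only [h1]; ring)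
    _ = _ := c
    _ = _ := by rw [← e1, ← e2, ← e3, ← e4, o1, o3]; ring

/-- The mollified pairing of a function with itself in terms of increments. -/
lemma integral_sq_sub_integral_mul_moll (hf : TorusFn b f) (hk : Integrable k)
    (hk1 : ∫ z, k z = 1) :
    2 * ((∫ x in ZSpan.fundamentalDomain b, f x * f x) -
      ∫ x in ZSpan.fundamentalDomain b, f x * moll k f x) =
        ∫ z, (∫ x in ZSpan.fundamentalDomain b, (f (x + z) - f x) ^ 2) * k z := by
  have hff := hf.mul hf
  have h1 : ∀ z, ∫ x in ZSpan.fundamentalDomain b, (f (x + z) - f x) ^ 2 =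
      2 * (∫ x in ZSpan.fundamentalDomain b, f x * f x) - 2 * corr b f f z := by
    intro z
    have i1 := (hf.mul (hf.comp_add z)).integrableOn
    have i2 := hff.integrableOn
    have i3 := (hff.comp_add z).integrableOn
    have e := integral_cell_add hff.periodic z
    have c := integral_linear_combination i3 i2 i1 i1 1 1 (-2) 0
    calc _ = _ := integral_congr_ae (.of_forall fun x => by ring)
      _ = _ := c
      _ = _ := by rw [e, corr]; ring
  simp only [h1, sub_mul]
  have j1 := hf.integrable_corr_mul hf hk
  have : ∀ z, 2 * corr b f f z * k z = 2 * (corr b f f z * k z) := fun z => mul_assoc _ _ _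
  simp only [this]
  rw [integral_sub (hk.const_mul _) (j1.const_mul _), integral_const_mul, integral_const_mul, hk1,
    ← hf.integral_mul_moll hf hk]
  ring

end TorusFn

/-- Turns a pointwise Hölder bound on increments into a moment of the kernel, from which the power
of ε is read off. -/
lemma abs_integral_cell_mul_le {F : E n → E n → ℝ} {k : E n → ℝ} {A β : ℝ}
    (hF : ∀ z x, |F z x| ≤ A * ‖z‖ ^ β)
    (hki : Integrable fun z => |k z| * ‖z‖ ^ β) :
    |∫ z, (∫ x in ZSpan.fundamentalDomain b, F z x) * k z| ≤
      A * volume.real (ZSpan.fundamentalDomain b) * ∫ z, |k z| * ‖z‖ ^ β := by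
  rw [← integral_const_mul, ← Real.norm_eq_abs]
  refine norm_integral_le_of_norm_le (hki.const_mul _) (.of_forall fun z => ?_)
  rw [norm_mul, Real.norm_eq_abs (k z)]
  have := norm_setIntegral_le_of_norm_le_const (f := F z) (volume_cell_lt_top (b := b))
    fun x _ => hF z x
  calc _ ≤ A * ‖z‖ ^ β * volume.real (ZSpan.fundamentalDomain b) * |k z| := by gcongr
    _ = _ := by ring

lemma integrable_abs_mul_rpow {k : E n → ℝ} (hk : Continuous k) (hks : HasCompactSupport k)
    {β : ℝ} (hβ : 0 ≤ β) : Integrable fun z => |k z| * ‖z‖ ^ β := by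
  refine Continuous.integrable_of_hasCompactSupport ?_ ?_
  · exact hk.abs.mul (continuous_norm.rpow_const fun _ => .inr hβ)
  · exact (hks.comp_left (g := fun x : ℝ => |x|) abs_zero).mul_right

end TorusFunctions

/-! ### Mollified energy and the energy flux. -/

section Energy

open Filter Topology

variable {n : ℕ}

/-- The energy of the velocity mollified with the kernel `ψ`. -/
noncomputable def mollEnergy (b : Module.Basis (Fin n) ℝ (E n)) (w : ℝ → E n → E n)
    (ψ : E n → ℝ) (t : ℝ) : ℝ :=
  2⁻¹ * ∑ l, ∫ x in ZSpan.fundamentalDomain b, w t x l * moll ψ (fun y => w t y l) x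

/-- The energy flux through the scale of the kernel `ψ`. -/
noncomputable def flux (b : Module.Basis (Fin n) ℝ (E n)) (w : ℝ → E n → E n)
    (ψ : E n → ℝ) (r τ : ℝ) : ℝ :=
  ∑ l, ∑ j, ∫ x in ZSpan.fundamentalDomain b,
    w r x j * w r x l * moll (pd j ψ) (fun y => w τ y l) x

/-- The momentum balance, tested with the kernel `φ`, between any two times in `T`. -/
def MomentumBalance (I T : Set ℝ) (w : ℝ → E n → E n) (p : ℝ → E n → ℝ) (φ : E n → ℝ) : Prop :=
  ∀ s t, s ∈ T → t ∈ T → s ∈ I → t ∈ I → s < t → ∀ l x,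
    moll φ (fun y => w t y l) x - moll φ (fun y => w s y l) x =
      (∑ j, moll (pd j φ) (fun y => ∫ r in Icc s t, w r y j * w r y l) x) +
        moll (pd l φ) (fun y => ∫ r in Icc s t, p r y) x

/-- A smooth even compactly supported kernel of integral one. -/
structure EvenKernel (ψ : E n → ℝ) : Prop where
  smooth : ContDiff ℝ ∞ ψ
  compactSupport : HasCompactSupport ψ
  even : ∀ z, ψ (-z) = ψ z
  integral_eq_one : ∫ z, ψ z = 1

namespace EvenKernel

variable {ψ : E n → ℝ}

lemma integrable (hψ : EvenKernel ψ) : Integrable ψ :=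
  hψ.smooth.continuous.integrable_of_hasCompactSupport hψ.compactSupport

lemma integrable_pd (hψ : EvenKernel ψ) (j : Fin n) : Integrable (pd j ψ) :=
  (contDiff_pd hψ.smooth j).continuous.integrable_of_hasCompactSupport
    (hasCompactSupport_pd hψ.compactSupport j)

lemma pd_neg (hψ : EvenKernel ψ) (j : Fin n) (z : E n) : pd j ψ (-z) = -pd j ψ z :=
  pd_neg_of_even hψ.smooth hψ.even j z

lemma continuous_moll_pd (hψ : EvenKernel ψ) (j : Fin n) {q : E n → ℝ}
    (hq : LocallyIntegrable q) : Continuous (moll (pd j ψ) q) :=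
  continuous_moll (contDiff_pd hψ.smooth j).continuous
    (hasCompactSupport_pd hψ.compactSupport j) hq

end EvenKernel

lemma evenKernel_kernel {ε : ℝ} (hε : 0 < ε) : EvenKernel (kernel n ε) :=
  ⟨contDiff_kernel ε, hasCompactSupport_kernel hε, kernel_neg ε, integral_kernel hε⟩

namespace BoundedSolution

variable {b : Module.Basis (Fin n) ℝ (E n)} {I : Set ℝ} {α M : ℝ} {w : ℝ → E n → E n}
  {p : ℝ → E n → ℝ} {ψ : E n → ℝ}

lemma torusFn (h : BoundedSolution b I α M w p) (hα : 0 < α) (t : ℝ) (l : Fin n) :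
    TorusFn b (fun x => w t x l) :=
  ⟨h.continuous_apply hα t l, (h.periodic t).map fun v => v l, M, fun x => h.abs_apply_le t x l⟩

lemma abs_increment_le (h : BoundedSolution b I α M w p) (t : ℝ) (x z : E n) (l : Fin n) :
    |w t (x + z) l - w t x l| ≤ M * ‖z‖ ^ α := by
  have h1 := PiLp.norm_apply_le (w t (x + z) - w t x) l
  have h2 := h.holder t (x + z) x
  rw [add_sub_cancel_left] at h2
  exact h1.trans h2

lemma energy_eq (h : BoundedSolution b I α M w p) (hα : 0 < α) (t : ℝ) :
    energy b w t = 2⁻¹ * ∑ l, ∫ x in ZSpan.fundamentalDomain b, w t x l * w t x l := by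
  rw [← integral_finsetSum _ fun l _ => ((h.torusFn hα t l).mul (h.torusFn hα t l)).integrableOn,
    ← integral_const_mul, energy]
  congr 1; ext x
  rw [EuclideanSpace.real_norm_sq_eq, div_eq_inv_mul]
  simp only [sq]

/-- The defect is a quarter of the ψ-weighted integral of squared increments, each at most
M²‖z‖^{2α}. The factor ¼ is discarded. -/
lemma abs_energy_sub_mollEnergy_le (h : BoundedSolution b I α M w p) (hα : 0 < α)
    (hψ : EvenKernel ψ) (t : ℝ) :
    |energy b w t - mollEnergy b w ψ t| ≤
      n * M ^ 2 * volume.real (ZSpan.fundamentalDomain b) * ∫ z, |ψ z| * ‖z‖ ^ (2 * α) := by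
  have hi := integrable_abs_mul_rpow hψ.smooth.continuous hψ.compactSupport
    (β := 2 * α) (by positivity)
  have key : ∀ l, |2 * ((∫ x in ZSpan.fundamentalDomain b, w t x l * w t x l) -
      ∫ x in ZSpan.fundamentalDomain b, w t x l * moll ψ (fun y => w t y l) x)| ≤
      M ^ 2 * volume.real (ZSpan.fundamentalDomain b) * ∫ z, |ψ z| * ‖z‖ ^ (2 * α) := by
    intro l
    rw [(h.torusFn hα t l).integral_sq_sub_integral_mul_moll hψ.integrable hψ.integral_eq_one]
    refine abs_integral_cell_mul_le (fun z x => ?_) hi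
    rw [abs_pow, mul_comm 2 α, Real.rpow_mul (norm_nonneg _), Real.rpow_two, ← mul_pow]
    exact pow_le_pow_left₀ (abs_nonneg _) (h.abs_increment_le t x z l) 2
  have e : energy b w t - mollEnergy b w ψ t =
      4⁻¹ * ∑ l, 2 * ((∫ x in ZSpan.fundamentalDomain b, w t x l * w t x l) -
        ∫ x in ZSpan.fundamentalDomain b, w t x l * moll ψ (fun y => w t y l) x) := by
    rw [h.energy_eq hα, mollEnergy, ← mul_sub, ← Finset.sum_sub_distrib, ← Finset.mul_sum]
    ring
  rw [e, abs_mul, abs_of_pos (by norm_num : (0 : ℝ) < 4⁻¹)]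
  have h1 : |∑ l, 2 * ((∫ x in ZSpan.fundamentalDomain b, w t x l * w t x l) -
        ∫ x in ZSpan.fundamentalDomain b, w t x l * moll ψ (fun y => w t y l) x)| ≤ _ :=
    (Finset.abs_sum_le_sum_abs _ _).trans (Finset.sum_le_sum fun l _ => key l)
  rw [Finset.sum_const, Finset.card_univ, Fintype.card_fin, nsmul_eq_mul] at h1
  calc _ ≤ 1 * _ := mul_le_mul (by norm_num) h1 (abs_nonneg _) zero_le_one
    _ = _ := by ring

/-- The scale-`ψ` flux of a Hölder continuous divergence-free velocity is a cubic quantity in the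
velocity increments. -/
lemma abs_flux_le (h : BoundedSolution b I α M w p) (hα : 0 < α) (hψ : EvenKernel ψ) {r : ℝ}
    (hdiv : ∀ x, ∑ j, moll (pd j ψ) (fun y => w r y j) x = 0) :
    |flux b w ψ r r| ≤ n * M ^ 3 * volume.real (ZSpan.fundamentalDomain b) *
      ∑ j, ∫ z, |pd j ψ z| * ‖z‖ ^ (3 * α) := by
  set D := ZSpan.fundamentalDomain b with hD
  have hi : ∀ j, Integrable fun z => |pd j ψ z| * ‖z‖ ^ (3 * α) := fun j =>
    integrable_abs_mul_rpow (contDiff_pd hψ.smooth j).continuous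
      (hasCompactSupport_pd hψ.compactSupport j) (by positivity)
  set X : Fin n → Fin n → ℝ := fun l j => ∫ z, (∫ x in D,
    (w r (x + z) j - w r x j) * (w r (x + z) l - w r x l) ^ 2) * pd j ψ z with hX
  have hXle : ∀ l j, |X l j| ≤ M ^ 3 * volume.real D * ∫ z, |pd j ψ z| * ‖z‖ ^ (3 * α) := by
    intro l j
    refine abs_integral_cell_mul_le (fun z x => ?_) (hi j)
    rw [abs_mul, abs_pow, mul_comm 3 α, Real.rpow_mul (norm_nonneg _),
      show (3 : ℝ) = (3 : ℕ) by norm_num, Real.rpow_natCast, ← mul_pow, pow_succ' _ 2]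
    exact mul_le_mul (h.abs_increment_le r x z j)
      (pow_le_pow_left₀ (abs_nonneg _) (h.abs_increment_le r x z l) 2) (by positivity)
      (mul_nonneg h.nonneg (by positivity))
  have hXeq : ∀ l j, X l j = 4 * (∫ x in D, w r x j * w r x l * moll (pd j ψ)
      (fun y => w r y l) x) + 2 * ∫ x in D, w r x l * w r x l * moll (pd j ψ)
        (fun y => w r y j) x := fun l j =>
    (h.torusFn hα r j).integral_increments_mul (h.torusFn hα r l) (hψ.integrable_pd j)
      (hψ.pd_neg j)
  -- The second term of the increment identity carries the mollified divergence once summed over j,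
  -- so only the flux survives, with coefficient 4.
  have hdiv' : ∀ l, ∑ j, ∫ x in D, w r x l * w r x l * moll (pd j ψ) (fun y => w r y j) x = 0 := by
    intro l
    rw [← integral_finsetSum]
    · simp only [← Finset.mul_sum, hdiv, mul_zero, integral_zero]
    · intro j _
      exact integrableOn_cell (((h.continuous_apply hα r l).mul (h.continuous_apply hα r l)).mul
        (hψ.continuous_moll_pd j (h.continuous_apply hα r j).locallyIntegrable)).locallyIntegrable
  have e : flux b w ψ r r = 4⁻¹ * ∑ l, ∑ j, X l j := by
    simp only [hXeq, Finset.sum_add_distrib, ← Finset.mul_sum, hdiv', mul_zero, add_zero]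
    rw [inv_mul_cancel_left₀ (by norm_num), flux]
  rw [e, abs_mul, abs_of_pos (by norm_num : (0 : ℝ) < 4⁻¹)]
  have h1 : |∑ l, ∑ j, X l j| ≤ ∑ l : Fin n, ∑ j : Fin n,
      M ^ 3 * volume.real D * ∫ z, |pd j ψ z| * ‖z‖ ^ (3 * α) :=
    (Finset.abs_sum_le_sum_abs _ _).trans (Finset.sum_le_sum fun l _ =>
      (Finset.abs_sum_le_sum_abs _ _).trans (Finset.sum_le_sum fun j _ => hXle l j))
  rw [Finset.sum_const, Finset.card_univ, Fintype.card_fin, nsmul_eq_mul, ← Finset.mul_sum] at h1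
  calc _ ≤ 1 * _ := mul_le_mul (by norm_num) h1 (abs_nonneg _) zero_le_one
    _ = _ := by ring

lemma stripIntegrable_mul (h : BoundedSolution b I α M w p) (j l : Fin n) :
    StripIntegrable I (fun z : ℝ × E n => w z.1 z.2 j * w z.1 z.2 l) :=
  .of_bounded ((h.measurable_apply j).mul (h.measurable_apply l)) fun _ => h.abs_mul_le _ _ _ _

lemma stripIntegrable_pressure (h : BoundedSolution b I α M w p) :
    StripIntegrable I (fun z : ℝ × E n => p z.1 z.2) :=
  .of_locallyIntegrableOn h.pressure_integrable

lemma isPeriodic_integral_mul (h : BoundedSolution b I α M w p) (s t : ℝ) (j l : Fin n) :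
    IsPeriodic b (fun y => ∫ r in Icc s t, w r y j * w r y l) := fun x γ hγ => by
  simp only [h.periodic _ x γ hγ]

lemma isPeriodic_integral_pressure (h : BoundedSolution b I α M w p) {s t : ℝ}
    (hI : Icc s t ⊆ I) : IsPeriodic b (fun y => ∫ r in Icc s t, p r y) := fun x γ hγ =>
  setIntegral_congr_fun measurableSet_Icc fun r hr => h.pressure_periodic r (hI hr) x γ hγ

/-- A strip-integrable function is integrable over a time interval times the fundamental cell. -/
lemma _root_.EulerTorus.StripIntegrable.integrable_cell {G : ℝ × E n → ℝ}
    (hG : StripIntegrable I G) {s t : ℝ} (hI : Icc s t ⊆ I) :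
    Integrable G ((volume.restrict (Icc s t)).prod
      (volume.restrict (ZSpan.fundamentalDomain b))) := by
  have h1 := (hG s t hI _ (ZSpan.fundamentalDomain_isBounded b).isCompact_closure).mono_set
    (prod_mono_right subset_closure)
  rwa [IntegrableOn, Measure.volume_eq_prod, ← Measure.prod_restrict] at h1

/-- The mollified energy balance. -/
lemma mollEnergy_sub (h : BoundedSolution b I α M w p) (hα : 0 < α) (hIc : I.OrdConnected)
    (hψ : EvenKernel ψ) {T : Set ℝ} (hbal : MomentumBalance I T w p ψ)
    (hdiv : ∀ t ∈ T, t ∈ I → ∀ x, ∑ j, moll (pd j ψ) (fun y => w t y j) x = 0)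
    {s t : ℝ} (hs : s ∈ T) (ht : t ∈ T) (hsI : s ∈ I) (htI : t ∈ I) (hst : s < t) :
    mollEnergy b w ψ t - mollEnergy b w ψ s =
      -2⁻¹ * ∫ r in Icc s t, (flux b w ψ r t + flux b w ψ r s) := by
  set D := ZSpan.fundamentalDomain b with hD
  have hI : Icc s t ⊆ I := hIc.out hsI htI
  have tf := h.torusFn hα
  have hu : ∀ l, TorusFn b (fun x => w t x l + w s x l) := fun l => (tf t l).add (tf s l)
  have hψi := hψ.integrable
  have mc : ∀ (τ : ℝ) (l : Fin n), Continuous (moll ψ (fun y => w τ y l)) := fun τ l =>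
    continuous_moll hψ.smooth.continuous hψ.compactSupport
      (h.continuous_apply hα τ l).locallyIntegrable
  have mi : ∀ (σ τ : ℝ) (l : Fin n),
      IntegrableOn (fun x => w σ x l * moll ψ (fun y => w τ y l) x) D := fun σ τ l =>
    integrableOn_cell ((h.continuous_apply hα σ l).mul (mc τ l)).locallyIntegrable
  set q : Fin n → Fin n → E n → ℝ := fun l j y => ∫ r in Icc s t, w r y j * w r y l with hq
  set P : E n → ℝ := fun y => ∫ r in Icc s t, p r y with hP
  have hql : ∀ l j, LocallyIntegrable (q l j) := fun l j =>
    (h.stripIntegrable_mul j l).locallyIntegrable hI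
  have hPl : LocallyIntegrable P := h.stripIntegrable_pressure.locallyIntegrable hI
  have hmpd : ∀ (j l : Fin n) (τ : ℝ), Continuous (moll (pd j ψ) (fun y => w τ y l)) :=
    fun j l τ => hψ.continuous_moll_pd j (h.continuous_apply hα τ l).locallyIntegrable
  have hmadd : ∀ (j l : Fin n) x, moll (pd j ψ) (fun y => w t y l + w s y l) x =
      moll (pd j ψ) (fun y => w t y l) x + moll (pd j ψ) (fun y => w s y l) x := by
    intro j l x
    have hbi : ∀ τ, Integrable fun z => w τ (x + z) l * pd j ψ z := fun τ =>
      (hψ.integrable_pd j).bdd_mul (c := M)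
        ((h.continuous_apply hα τ l).comp (continuous_const_add x)).aestronglyMeasurable
        (.of_forall fun z => h.abs_apply_le τ _ l)
    rw [moll, moll, moll, ← integral_add (hbi t) (hbi s)]
    simp only [add_mul]
  -- the increment of the mollified energy, tested against the sum of the velocities
  have e1 : ∀ l, (∫ x in D, w t x l * moll ψ (fun y => w t y l) x) -
      (∫ x in D, w s x l * moll ψ (fun y => w s y l) x) =
      ∫ x in D, (w t x l + w s x l) *
        (moll ψ (fun y => w t y l) x - moll ψ (fun y => w s y l) x) := by
    intro l
    -- Evenness of ψ makes the two cross terms between times s and t equal, so they cancel in the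
    -- product of sum and difference.
    have hsymm := (tf t l).integral_mul_moll_even (tf s l) hψi hψ.even
    have c := integral_linear_combination (mi t t l) (mi t s l) (mi s t l) (mi s s l) 1 (-1) 1 (-1)
    calc _ = _ := by rw [hsymm]; ring
      _ = _ := c.symm
      _ = _ := integral_congr_ae (.of_forall fun x => by ring)
  have e2 : ∀ l, ∫ x in D, (w t x l + w s x l) *
        (moll ψ (fun y => w t y l) x - moll ψ (fun y => w s y l) x) =
      (∑ j, ∫ x in D, (w t x l + w s x l) * moll (pd j ψ) (q l j) x) +
        ∫ x in D, (w t x l + w s x l) * moll (pd l ψ) P x := by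
    intro l
    simp only [hbal s t hs ht hsI htI hst l, mul_add, Finset.mul_sum]
    rw [integral_add, integral_finsetSum]
    · exact fun j _ => integrableOn_cell ((hu l).continuous.mul
        (hψ.continuous_moll_pd j (hql l j))).locallyIntegrable
    · exact integrable_finsetSum _ fun j _ => integrableOn_cell ((hu l).continuous.mul
        (hψ.continuous_moll_pd j (hql l j))).locallyIntegrable
    · exact integrableOn_cell ((hu l).continuous.mul
        (hψ.continuous_moll_pd l hPl)).locallyIntegrable
  -- the pressure does no work
  have e3 : ∑ l, ∫ x in D, (w t x l + w s x l) * moll (pd l ψ) P x = 0 := by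
    -- The derivative moves from the pressure onto w(t) + w(s). Both endpoint times lie in T, where
    -- the mollified divergence vanishes.
    have : ∀ l, ∫ x in D, (w t x l + w s x l) * moll (pd l ψ) P x =
        -∫ x in D, P x * moll (pd l ψ) (fun y => w t y l + w s y l) x := fun l =>
      (hu l).integral_mul_moll_odd hPl (h.isPeriodic_integral_pressure hI)
        (hψ.integrable_pd l) (hψ.pd_neg l)
    simp only [this, Finset.sum_neg_distrib]
    rw [← integral_finsetSum]
    · simp only [← Finset.mul_sum, hmadd, Finset.sum_add_distrib, hdiv t ht htI, hdiv s hs hsI,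
        add_zero, mul_zero, integral_zero, neg_zero]
    · intro l _
      exact (integrableOn_cell hPl).mul_bdd
        (hψ.continuous_moll_pd l (hu l).continuous.locallyIntegrable).aestronglyMeasurable
        (.of_forall fun x => abs_moll_le (C := M + M) (hψ.integrable_pd l)
          (fun y => (abs_add_le _ _).trans (add_le_add (h.abs_apply_le t y l)
            (h.abs_apply_le s y l))) x)
  -- the nonlinear term is the time integral of the flux
  have hbi : ∀ (l j : Fin n) (τ : ℝ), Integrable
      (fun z : ℝ × E n => w z.1 z.2 j * w z.1 z.2 l * moll (pd j ψ) (fun y => w τ y l) z.2)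
      ((volume.restrict (Icc s t)).prod (volume.restrict D)) := fun l j τ =>
    ((h.stripIntegrable_mul j l).integrable_cell hI).mul_bdd
      ((hmpd j l τ).comp continuous_snd).aestronglyMeasurable
      (.of_forall fun z => abs_moll_le (hψ.integrable_pd j) (fun y => h.abs_apply_le τ y l) z.2)
  have e4 : ∀ l j, ∫ x in D, (w t x l + w s x l) * moll (pd j ψ) (q l j) x =
      -((∫ r in Icc s t, ∫ x in D, w r x j * w r x l * moll (pd j ψ) (fun y => w t y l) x) +
        ∫ r in Icc s t, ∫ x in D, w r x j * w r x l * moll (pd j ψ) (fun y => w s y l) x) := by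
    intro l j
    -- Moving the kernel onto the velocities leaves the time integral of w⊗w unmollified; Fubini
    -- then brings the time integral outside.
    have hsw := (hu l).integral_mul_moll_odd (hql l j) (h.isPeriodic_integral_mul s t j l)
      (hψ.integrable_pd j) (hψ.pd_neg j)
    rw [hsw]
    congr 1
    have hf : ∀ τ, ∫ r in Icc s t, ∫ x in D, w r x j * w r x l *
        moll (pd j ψ) (fun y => w τ y l) x =
        ∫ x in D, q l j x * moll (pd j ψ) (fun y => w τ y l) x := by
      intro τ
      rw [integral_integral_swap (hbi l j τ)]
      simp only [hq, integral_mul_const]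
    have hqi : ∀ τ, IntegrableOn (fun x => q l j x * moll (pd j ψ) (fun y => w τ y l) x) D :=
      fun τ => (integrableOn_cell (hql l j)).mul_bdd (hmpd j l τ).aestronglyMeasurable
        (.of_forall fun x => abs_moll_le (hψ.integrable_pd j) (fun y => h.abs_apply_le τ y l) x)
    rw [hf, hf, ← integral_add (hqi t) (hqi s), ← hD]
    simp only [hmadd, mul_add]
  have hfl : ∀ τ, Integrable (fun r => flux b w ψ r τ) (volume.restrict (Icc s t)) := fun τ =>
    integrable_finsetSum _ fun l _ => integrable_finsetSum _ fun j _ =>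
      (hbi l j τ).integral_prod_left
  have e5 : ∀ τ, ∫ r in Icc s t, flux b w ψ r τ = ∑ l, ∑ j,
      ∫ r in Icc s t, ∫ x in D, w r x j * w r x l * moll (pd j ψ) (fun y => w τ y l) x := by
    intro τ
    simp only [flux]
    rw [integral_finsetSum _ fun l _ => integrable_finsetSum _ fun j _ =>
      (hbi l j τ).integral_prod_left]
    refine Finset.sum_congr rfl fun l _ => ?_
    rw [integral_finsetSum _ fun j _ => (hbi l j τ).integral_prod_left]
  rw [integral_add (hfl t) (hfl s), e5, e5, mollEnergy, mollEnergy, ← mul_sub,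
    ← Finset.sum_sub_distrib, ← hD]
  simp only [e1, e2, Finset.sum_add_distrib, e3, add_zero, e4, Finset.sum_neg_distrib]
  ring

/-- The weight controlling the time modulus of the mollified velocity. -/
noncomputable def timeWeight (b : Module.Basis (Fin n) ℝ (E n)) (M : ℝ) (p : ℝ → E n → ℝ)
    (r : ℝ) : ℝ :=
  M * M * volume.real (ZSpan.fundamentalDomain b) + ∫ x in ZSpan.fundamentalDomain b, |p r x|

lemma timeWeight_nonneg (h : BoundedSolution b I α M w p) (r : ℝ) : 0 ≤ timeWeight b M p r :=
  add_nonneg (mul_nonneg (mul_nonneg h.nonneg h.nonneg) measureReal_nonneg)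
    (integral_nonneg fun _ => abs_nonneg _)

lemma integrableOn_timeWeight (h : BoundedSolution b I α M w p) {s t : ℝ} (hI : Icc s t ⊆ I) :
    IntegrableOn (timeWeight b M p) (Icc s t) :=
  (integrable_const _).add
    ((h.stripIntegrable_pressure.integrable_cell (b := b) hI).abs).integral_prod_left

/-- The constant part M²·vol of the weight takes care of the quadratic term. The same weight also
dominates the pressure, so one function of time serves every term of the momentum balance. -/
lemma integral_abs_integral_mul_le (h : BoundedSolution b I α M w p) {s t : ℝ} (hst : s ≤ t)
    (hI : Icc s t ⊆ I) (j l : Fin n) :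
    ∫ x in ZSpan.fundamentalDomain b, |∫ r in Icc s t, w r x j * w r x l| ≤
      ∫ r in Icc s t, timeWeight b M p r := by
  have h1 : ∫ x in ZSpan.fundamentalDomain b, |∫ r in Icc s t, w r x j * w r x l| ≤
      ∫ x in ZSpan.fundamentalDomain b, M * M * (t - s) := by
    refine integral_mono_of_nonneg (.of_forall fun _ => abs_nonneg _) (integrable_const _)
      (.of_forall fun x => ?_)
    have := norm_setIntegral_le_of_norm_le_const (μ := volume) (s := Icc s t)
      (f := fun r => w r x j * w r x l) (by simp) fun r _ => h.abs_mul_le r x j l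
    rwa [Real.volume_real_Icc_of_le hst] at this
  have h2 : ∫ r in Icc s t, M * M * volume.real (ZSpan.fundamentalDomain b) ≤
      ∫ r in Icc s t, timeWeight b M p r :=
    integral_mono (integrable_const _) (h.integrableOn_timeWeight hI) fun r =>
      le_add_of_nonneg_right (integral_nonneg fun _ => abs_nonneg _)
  rw [setIntegral_const, smul_eq_mul] at h1 h2
  rw [Real.volume_real_Icc_of_le hst] at h2
  linarith

lemma integral_abs_integral_pressure_le (h : BoundedSolution b I α M w p) {s t : ℝ}
    (hI : Icc s t ⊆ I) :
    ∫ x in ZSpan.fundamentalDomain b, |∫ r in Icc s t, p r x| ≤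
      ∫ r in Icc s t, timeWeight b M p r := by
  have hi := (h.stripIntegrable_pressure.integrable_cell (b := b) hI).abs
  calc _ ≤ ∫ x in ZSpan.fundamentalDomain b, ∫ r in Icc s t, |p r x| :=
        integral_mono_of_nonneg (.of_forall fun _ => abs_nonneg _) hi.integral_prod_right
          (.of_forall fun _ => abs_integral_le_integral_abs)
    _ = ∫ r in Icc s t, ∫ x in ZSpan.fundamentalDomain b, |p r x| :=
        (integral_integral_swap hi).symm
    _ ≤ _ := integral_mono hi.integral_prod_left (h.integrableOn_timeWeight hI) fun r =>
        le_add_of_nonneg_left (mul_nonneg (mul_nonneg h.nonneg h.nonneg) measureReal_nonneg)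

/-- The flux is continuous in its second time argument, with the modulus given by `timeWeight`. -/
lemma abs_flux_sub_le (h : BoundedSolution b I α M w p) (hα : 0 < α) (hIc : I.OrdConnected)
    (hψ : EvenKernel ψ) {T : Set ℝ} (hbal : ∀ j, MomentumBalance I T w p (pd j ψ))
    {s t : ℝ} (hs : s ∈ T) (ht : t ∈ T) (hsI : s ∈ I) (htI : t ∈ I) (hst : s < t) (r : ℝ) :
    |flux b w ψ r t - flux b w ψ r s| ≤
      (2 * n * (M * M) * ∑ j, ∑ i, ∫ z, |pd i (pd j ψ) z|) *
        ∫ r in Icc s t, timeWeight b M p r := by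
  have hI : Icc s t ⊆ I := hIc.out hsI htI
  set Γ := ∫ r in Icc s t, timeWeight b M p r with hΓ
  have hΓ0 : 0 ≤ Γ := integral_nonneg fun r => h.timeWeight_nonneg r
  have hMM : 0 ≤ M * M := mul_nonneg h.nonneg h.nonneg
  have hki : ∀ i j, Integrable (pd i (pd j ψ)) := fun i j =>
    (contDiff_pd (contDiff_pd hψ.smooth j) i).continuous.integrable_of_hasCompactSupport
      (hasCompactSupport_pd (hasCompactSupport_pd hψ.compactSupport j) i)
  have hkm : ∀ (i j : Fin n) {q : E n → ℝ}, LocallyIntegrable q →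
      IntegrableOn (moll (pd i (pd j ψ)) q) (ZSpan.fundamentalDomain b) := fun i j _ hq =>
    integrableOn_cell (continuous_moll (contDiff_pd (contDiff_pd hψ.smooth j) i).continuous
      (hasCompactSupport_pd (hasCompactSupport_pd hψ.compactSupport j) i) hq).locallyIntegrable
  have hq : ∀ i l, LocallyIntegrable (fun y => ∫ r in Icc s t, w r y i * w r y l) := fun i l =>
    (h.stripIntegrable_mul i l).locallyIntegrable hI
  have hP : LocallyIntegrable (fun y => ∫ r in Icc s t, p r y) :=
    h.stripIntegrable_pressure.locallyIntegrable hI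
  have hmpd : ∀ (j l : Fin n) (τ : ℝ), Continuous (moll (pd j ψ) (fun y => w τ y l)) :=
    fun j l τ => hψ.continuous_moll_pd j (h.continuous_apply hα τ l).locallyIntegrable
  -- The momentum balance with kernel ∂ⱼψ expresses this difference through second derivatives of ψ,
  -- and Young's inequality bounds each term in L¹ of the cell.
  have hdiff : ∀ l j, ∫ x in ZSpan.fundamentalDomain b,
      |moll (pd j ψ) (fun y => w t y l) x - moll (pd j ψ) (fun y => w s y l) x| ≤
        2 * Γ * ∑ i, ∫ z, |pd i (pd j ψ) z| := by
    intro l j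
    have hN : ∀ i, 0 ≤ ∫ z, |pd i (pd j ψ) z| := fun i => integral_nonneg fun _ => abs_nonneg _
    calc _ ≤ ∫ x in ZSpan.fundamentalDomain b,
          ((∑ i, |moll (pd i (pd j ψ)) (fun y => ∫ r in Icc s t, w r y i * w r y l) x|) +
            |moll (pd l (pd j ψ)) (fun y => ∫ r in Icc s t, p r y) x|) := by
          refine integral_mono_of_nonneg (.of_forall fun _ => abs_nonneg _)
            ((integrable_finsetSum _ fun i _ => (hkm i j (hq i l)).abs).add (hkm l j hP).abs)
            (.of_forall fun x => ?_)
          simp only [hbal j s t hs ht hsI htI hst l x]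
          exact (abs_add_le _ _).trans (add_le_add_left (Finset.abs_sum_le_sum_abs _ _) _)
      _ = (∑ i, ∫ x in ZSpan.fundamentalDomain b,
            |moll (pd i (pd j ψ)) (fun y => ∫ r in Icc s t, w r y i * w r y l) x|) +
            ∫ x in ZSpan.fundamentalDomain b,
              |moll (pd l (pd j ψ)) (fun y => ∫ r in Icc s t, p r y) x| := by
          rw [integral_add (integrable_finsetSum _ fun i _ => (hkm i j (hq i l)).abs)
            (hkm l j hP).abs, integral_finsetSum _ fun i _ => (hkm i j (hq i l)).abs]
      _ ≤ (∑ i, Γ * ∫ z, |pd i (pd j ψ) z|) + Γ * ∫ z, |pd l (pd j ψ) z| := by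
          refine add_le_add (Finset.sum_le_sum fun i _ => ?_) ?_
          · exact (integral_abs_moll_le (hki i j) (hq i l)
              (h.isPeriodic_integral_mul s t i l)).trans
              (mul_le_mul_of_nonneg_right (h.integral_abs_integral_mul_le hst.le hI i l) (hN i))
          · exact (integral_abs_moll_le (hki l j) hP (h.isPeriodic_integral_pressure hI)).trans
              (mul_le_mul_of_nonneg_right (h.integral_abs_integral_pressure_le hI) (hN l))
      -- The single pressure term is enlarged to the full sum over i, whence the factor 2.
      _ ≤ (∑ i, Γ * ∫ z, |pd i (pd j ψ) z|) + ∑ i, Γ * ∫ z, |pd i (pd j ψ) z| := by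
          gcongr
          exact Finset.single_le_sum (f := fun i => Γ * ∫ z, |pd i (pd j ψ) z|)
            (fun i _ => mul_nonneg hΓ0 (hN i)) (Finset.mem_univ l)
      _ = _ := by rw [← Finset.mul_sum]; ring
  have hterm : ∀ l j, |(∫ x in ZSpan.fundamentalDomain b,
      w r x j * w r x l * moll (pd j ψ) (fun y => w t y l) x) -
      ∫ x in ZSpan.fundamentalDomain b,
        w r x j * w r x l * moll (pd j ψ) (fun y => w s y l) x| ≤
        M * M * (2 * Γ * ∑ i, ∫ z, |pd i (pd j ψ) z|) := by
    intro l j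
    have hi : ∀ τ, IntegrableOn (fun x => w r x j * w r x l *
        moll (pd j ψ) (fun y => w τ y l) x) (ZSpan.fundamentalDomain b) := fun τ =>
      integrableOn_cell (((h.continuous_apply hα r j).mul (h.continuous_apply hα r l)).mul
        (hmpd j l τ)).locallyIntegrable
    rw [← integral_sub (hi t) (hi s)]
    refine abs_integral_le_integral_abs.trans ?_
    refine le_trans ?_ (mul_le_mul_of_nonneg_left (hdiff l j) hMM)
    rw [← integral_const_mul]
    refine integral_mono_of_nonneg (.of_forall fun _ => abs_nonneg _)
      ((integrableOn_cell ((hmpd j l t).sub (hmpd j l s)).locallyIntegrable).abs.const_mul _)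
      (.of_forall fun x => ?_)
    simp only [← mul_sub]
    rw [abs_mul]
    exact mul_le_mul_of_nonneg_right (h.abs_mul_le r x j l) (abs_nonneg _)
  have hsum : flux b w ψ r t - flux b w ψ r s = ∑ l, ∑ j,
      ((∫ x in ZSpan.fundamentalDomain b,
        w r x j * w r x l * moll (pd j ψ) (fun y => w t y l) x) -
      ∫ x in ZSpan.fundamentalDomain b,
        w r x j * w r x l * moll (pd j ψ) (fun y => w s y l) x) := by
    simp only [flux, Finset.sum_sub_distrib]
  rw [hsum]
  refine ((Finset.abs_sum_le_sum_abs _ _).trans (Finset.sum_le_sum fun l _ =>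
    (Finset.abs_sum_le_sum_abs _ _).trans (Finset.sum_le_sum fun j _ => hterm l j))).trans ?_
  rw [Finset.sum_const, Finset.card_univ, Fintype.card_fin, nsmul_eq_mul, ← Finset.mul_sum,
    ← Finset.mul_sum]
  exact le_of_eq (by ring)

/-- The mollified energy is Lipschitz on a conull set of times, with a constant that only depends
on the bound for the flux. -/
lemma exists_mollEnergy_lipschitz (h : BoundedSolution b I α M w p) (hα : 0 < α)
    (hIo : IsOpen I) (hIc : I.OrdConnected) (hψ : EvenKernel ψ) :
    ∃ T : Set ℝ, (∀ᵐ t, t ∈ T) ∧ ∀ s t, s ∈ T → t ∈ T → s ∈ I → t ∈ I → s < t →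
      |mollEnergy b w ψ t - mollEnergy b w ψ s| ≤
        (n * M ^ 3 * volume.real (ZSpan.fundamentalDomain b) *
          ∑ j, ∫ z, |pd j ψ z| * ‖z‖ ^ (3 * α)) * (t - s) := by
  obtain ⟨T₀, hT₀, hbal₀⟩ := h.exists_momentum_balance hα hIo hIc hψ.smooth hψ.compactSupport
  choose T₁ hT₁ hbal₁ using fun j => h.exists_momentum_balance hα hIo hIc
    (contDiff_pd hψ.smooth j) (hasCompactSupport_pd hψ.compactSupport j)
  have hdiv₀ := h.ae_sum_moll_pd_eq_zero hα hIo hψ.smooth hψ.compactSupport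
  -- Times good for three purposes: the balance for ψ gives the energy increment, the balances for
  -- ∂ⱼψ give the time modulus of the flux, and vanishing divergence gives the cubic bound.
  set T : Set ℝ := {t | t ∈ T₀ ∧ (∀ j, t ∈ T₁ j) ∧
    (t ∈ I → ∀ x, ∑ j, moll (pd j ψ) (fun y => w t y j) x = 0)} with hT
  have hTae : ∀ᵐ t, t ∈ T := by
    filter_upwards [hT₀, ae_all_iff.2 hT₁, hdiv₀] with t h1 h2 h3 using ⟨h1, h2, h3⟩
  have hbal : MomentumBalance I T w p ψ := fun s t hs ht => hbal₀ s t hs.1 ht.1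
  have hbal' : ∀ j, MomentumBalance I T w p (pd j ψ) := fun j s t hs ht =>
    hbal₁ j s t (hs.2.1 j) (ht.2.1 j)
  have hdiv : ∀ t ∈ T, t ∈ I → ∀ x, ∑ j, moll (pd j ψ) (fun y => w t y j) x = 0 :=
    fun t ht => ht.2.2
  refine ⟨T, hTae, fun s t hs ht hsI htI hst => ?_⟩
  set K := n * M ^ 3 * volume.real (ZSpan.fundamentalDomain b) *
    ∑ j, ∫ z, |pd j ψ z| * ‖z‖ ^ (3 * α) with hK
  set C := 2 * n * (M * M) * ∑ j, ∑ i, ∫ z, |pd i (pd j ψ) z| with hC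
  have hC0 : 0 ≤ C := by
    have : 0 ≤ ∑ j : Fin n, ∑ i : Fin n, ∫ z, |pd i (pd j ψ) z| :=
      Finset.sum_nonneg fun j _ => Finset.sum_nonneg fun i _ =>
        integral_nonneg fun _ => abs_nonneg _
    have := mul_self_nonneg M
    positivity
  -- The constant C involves second derivatives of ψ, but subdivision removes it and only K remains.
  refine abs_sub_le_of_increment_bound hIc hTae hC0
    (fun s t hI => h.integrableOn_timeWeight (b := b) hI) ?_ hs ht hsI htI hst
  clear s t hs ht hsI htI hst
  intro s t hs ht hsI htI hst
  have hI : Icc s t ⊆ I := hIc.out hsI htI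
  rw [h.mollEnergy_sub hα hIc hψ hbal hdiv hs ht hsI htI hst, abs_mul]
  have hΓ : ∀ a c, s ≤ a → c ≤ t → ∫ r in Icc a c, timeWeight b M p r ≤
      ∫ r in Icc s t, timeWeight b M p r := fun a c ha hc =>
    setIntegral_mono_set (h.integrableOn_timeWeight hI)
      (.of_forall fun r => h.timeWeight_nonneg r) (Icc_subset_Icc ha hc).eventuallyLE
  have hΓ0 : 0 ≤ ∫ r in Icc s t, timeWeight b M p r :=
    integral_nonneg fun r => h.timeWeight_nonneg r
  have hbound : ∀ᵐ r ∂(volume.restrict (Icc s t)), ‖flux b w ψ r t + flux b w ψ r s‖ ≤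
      2 * (K + C * ∫ r in Icc s t, timeWeight b M p r) := by
    -- For almost every r both fluxes are compared with the diagonal one at r, to which the cubic
    -- bound applies.
    filter_upwards [ae_restrict_mem measurableSet_Icc, ae_restrict_of_ae hTae] with r hr hrT
    have hrI := hI hr
    have h0 := h.abs_flux_le hα hψ (hdiv r hrT hrI)
    have h1 : |flux b w ψ r t - flux b w ψ r r| ≤
        C * ∫ r in Icc s t, timeWeight b M p r := by
      rcases hr.2.eq_or_lt with rfl | hlt
      · rw [sub_self, abs_zero]; positivity
      · exact (h.abs_flux_sub_le hα hIc hψ hbal' hrT ht hrI htI hlt r).trans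
          (mul_le_mul_of_nonneg_left (hΓ _ _ hr.1 le_rfl) hC0)
    have h2 : |flux b w ψ r r - flux b w ψ r s| ≤
        C * ∫ r in Icc s t, timeWeight b M p r := by
      rcases hr.1.eq_or_lt with rfl | hlt
      · rw [sub_self, abs_zero]; positivity
      · exact (h.abs_flux_sub_le hα hIc hψ hbal' hs hrT hsI hrI hlt r).trans
          (mul_le_mul_of_nonneg_left (hΓ _ _ le_rfl hr.2) hC0)
    rw [Real.norm_eq_abs]
    rw [abs_le] at *
    constructor <;> linarith [h0.1, h0.2, h1.1, h1.2, h2.1, h2.2]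
  have := norm_setIntegral_le_of_norm_le_const_ae (by simp) hbound
  rw [Real.volume_real_Icc_of_le hst.le, Real.norm_eq_abs] at this
  rw [abs_neg, abs_of_pos (by norm_num : (0 : ℝ) < 2⁻¹)]
  linarith

end BoundedSolution

end Energy

/-! ### Choice of scale and reduction to bounded solutions. -/

section EnergyRegularity

open Filter Topology

variable {n : ℕ}

/-- A dyadic length scale balancing the mollification error against the energy flux. -/
lemma exists_dyadic_scale {α τ : ℝ} (hα0 : 0 < α) (hα1 : α < 1) (hτ : 0 < τ) :
    ∃ k : ℤ, ((2 : ℝ) ^ k) ^ (2 * α) ≤ τ ^ (2 * α / (1 - α)) ∧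
      ((2 : ℝ) ^ k) ^ (3 * α - 1) * τ ≤ 2 * τ ^ (2 * α / (1 - α)) := by
  have hα : 0 < 1 - α := sub_pos.2 hα1
  set X := τ ^ (1 / (1 - α)) with hX
  have hXpos : 0 < X := Real.rpow_pos_of_pos hτ _
  -- X solves X^{2α} = X^{3α−1} τ, and 2^k is the dyadic number with 2^k ≤ X < 2^{k+1}.
  obtain ⟨k, hk1, hk2⟩ := exists_mem_Ico_zpow hXpos (one_lt_two (α := ℝ))
  set ε : ℝ := 2 ^ k with hε
  have hεpos : 0 < ε := by positivity
  have hk2' : X ≤ 2 * ε := by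
    rw [zpow_add_one₀ two_ne_zero, mul_comm] at hk2
    exact hk2.le
  have e1 : τ ^ (2 * α / (1 - α)) = X ^ (2 * α) := by
    rw [hX, ← Real.rpow_mul hτ.le]
    congr 1
    ring
  have e2 : τ = X ^ (1 - α) := by
    rw [hX, ← Real.rpow_mul hτ.le, one_div, inv_mul_cancel₀ hα.ne', Real.rpow_one]
  have h1 : ε ^ (2 * α) ≤ X ^ (2 * α) := Real.rpow_le_rpow hεpos.le hk1 (by positivity)
  refine ⟨k, by rw [e1]; exact h1, ?_⟩
  rw [e1]
  calc ε ^ (3 * α - 1) * τ = ε ^ (3 * α - 1) * X ^ (1 - α) := by rw [← e2]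
    -- The exponent 3α − 1 may have either sign, so X is replaced by 2ε only in the factor with
    -- positive exponent 1 − α.
    _ ≤ ε ^ (3 * α - 1) * (2 * ε) ^ (1 - α) := by gcongr
    _ = 2 ^ (1 - α) * ε ^ (2 * α) := by
        rw [Real.mul_rpow zero_le_two hεpos.le, mul_left_comm, ← Real.rpow_add hεpos]
        ring_nf
    _ ≤ 2 * X ^ (2 * α) := by
        gcongr
        calc (2 : ℝ) ^ (1 - α) ≤ 2 ^ (1 : ℝ) :=
              Real.rpow_le_rpow_of_exponent_le one_le_two (by linarith)
          _ = 2 := Real.rpow_one 2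

variable {b : Module.Basis (Fin n) ℝ (E n)} {I : Set ℝ} {α M : ℝ} {w : ℝ → E n → E n}
  {p : ℝ → E n → ℝ}

lemma BoundedSolution.exists_energy_bound (h : BoundedSolution b I α M w p) (hα0 : 0 < α)
    (hα1 : α < 1) (hIo : IsOpen I) (hIc : I.OrdConnected) :
    ∃ C : ℝ, ∃ T : Set ℝ, (∀ᵐ t, t ∈ T) ∧ ∀ s t, s ∈ T → t ∈ T → s ∈ I → t ∈ I →
      |energy b w t - energy b w s| ≤ C * |t - s| ^ (2 * α / (1 - α)) := by
  -- One conull set for each dyadic scale; being countably many, they have a conull intersection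
  -- that serves every pair of times.
  choose T hT hLip using fun k : ℤ => h.exists_mollEnergy_lipschitz hα0 hIo hIc
    (evenKernel_kernel (n := n) (ε := (2 : ℝ) ^ k) (by positivity))
  set V := volume.real (ZSpan.fundamentalDomain b)
  set m₀ := ∫ z, |baseKernel n z| * ‖z‖ ^ (2 * α)
  set m₁ := ∑ j : Fin n, ∫ z, |pd j (baseKernel n) z| * ‖z‖ ^ (3 * α)
  have hm₀ : 0 ≤ m₀ := integral_nonneg fun z => by positivity
  have hm₁ : 0 ≤ m₁ := Finset.sum_nonneg fun j _ => integral_nonneg fun z => by positivity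
  have hM := h.nonneg
  have hV : 0 ≤ V := measureReal_nonneg
  have hβ : 0 < 2 * α / (1 - α) := div_pos (by positivity) (sub_pos.2 hα1)
  -- The first factor 2 counts the mollification errors at s and t; the second comes from rounding
  -- the scale to a power of 2.
  have hlt : ∀ s t, (∀ k, s ∈ T k) → (∀ k, t ∈ T k) → s ∈ I → t ∈ I → s < t →
      |energy b w t - energy b w s| ≤
        (2 * (n * M ^ 2 * V * m₀) + 2 * (n * M ^ 3 * V * m₁)) *
          |t - s| ^ (2 * α / (1 - α)) := by
    intro s t hs ht hsI htI hst
    obtain ⟨k, hk1, hk2⟩ := exists_dyadic_scale hα0 hα1 (sub_pos.2 hst)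
    have hε : (0 : ℝ) < 2 ^ k := by positivity
    have hψ := evenKernel_kernel (n := n) hε
    have h1 := h.abs_energy_sub_mollEnergy_le hα0 hψ t
    have h2 := h.abs_energy_sub_mollEnergy_le hα0 hψ s
    have h3 := hLip k s t (hs k) (ht k) hsI htI hst
    rw [integral_kernel_moment hε] at h1 h2
    simp only [integral_pd_kernel_moment hε, ← Finset.mul_sum] at h3
    rw [abs_of_pos (sub_pos.2 hst)]
    have hA : n * M ^ 2 * V * ((2 ^ k) ^ (2 * α) * m₀) ≤
        n * M ^ 2 * V * m₀ * (t - s) ^ (2 * α / (1 - α)) := by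
      calc _ = n * M ^ 2 * V * m₀ * (2 ^ k) ^ (2 * α) := by ring
        _ ≤ _ := by gcongr
    have hB : n * M ^ 3 * V * ((2 ^ k) ^ (3 * α - 1) * m₁) * (t - s) ≤
        n * M ^ 3 * V * m₁ * (2 * (t - s) ^ (2 * α / (1 - α))) := by
      calc _ = n * M ^ 3 * V * m₁ * ((2 ^ k) ^ (3 * α - 1) * (t - s)) := by ring
        _ ≤ _ := by gcongr
    have h1' := h1.trans hA
    have h2' := h2.trans hA
    have h3' := h3.trans hB
    rw [abs_le] at *
    constructor <;> linarith [h1'.1, h1'.2, h2'.1, h2'.2, h3'.1, h3'.2]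
  refine ⟨2 * (n * M ^ 2 * V * m₀) + 2 * (n * M ^ 3 * V * m₁), {t | ∀ k, t ∈ T k},
    ae_all_iff.2 hT, fun s t hs ht hsI htI => ?_⟩
  rcases lt_trichotomy s t with hst | rfl | hst
  · exact hlt s t hs ht hsI htI hst
  · simp [Real.zero_rpow hβ.ne']
  · rw [abs_sub_comm, abs_sub_comm t]
    exact hlt t s ht hs htI hsI hst

/-- A Hölder bounded weak solution agrees, at almost all times, with one that is bounded at
all times. -/
lemma exists_boundedSolution {v : ℝ → E n → E n} (hI : MeasurableSet I)
    (hEuler : IsEulerSolution b I v p) (hv : BoundedHolder α I v) :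
    ∃ (M : ℝ) (w : ℝ → E n → E n), BoundedSolution b I α M w p ∧
      ∀ᵐ t, t ∈ I → v t = w t := by
  classical
  obtain ⟨M₀, hM₀⟩ := hv
  set M := max M₀ 0
  have hM : 0 ≤ M := le_max_right _ _
  set S : Set ℝ := {t | t ∈ I ∧ (∀ x, ‖v t x‖ ≤ M) ∧ ∀ x y, ‖v t x - v t y‖ ≤ M * ‖x - y‖ ^ α}
  have hS : ∀ᵐ t, t ∈ I → t ∈ S := by
    filter_upwards [(ae_restrict_iff' hI).1 hM₀] with t ht htI
    exact ⟨htI, fun x => ((ht htI).1 x).trans (le_max_left _ _), fun x y =>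
      ((ht htI).2 x y).trans (mul_le_mul_of_nonneg_right (le_max_left _ _) (by positivity))⟩
  -- Setting the velocity to zero at bad times, and outside I, preserves the bounds and periodicity.
  -- The change within I is on a null set of times, invisible to the weak equations.
  set w : ℝ → E n → E n := fun t => if t ∈ S then v t else 0
  have hwS : ∀ t ∈ S, w t = v t := fun t ht => if_pos ht
  have hw0 : ∀ t ∉ S, w t = 0 := fun t ht => if_neg ht
  have hIm : MeasurableSet (I ×ˢ (univ : Set (E n))) := hI.prod .univ
  have hae : ∀ᵐ z : ℝ × E n, z ∈ I ×ˢ (univ : Set (E n)) → v z.1 = w z.1 := by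
    filter_upwards [Measure.quasiMeasurePreserving_fst.ae hS] with z hz hzI
    exact (hwS _ (hz hzI.1)).symm
  refine ⟨M, w, ?_, ?_⟩
  swap
  · filter_upwards [hS] with t ht htI using (hwS t (ht htI)).symm
  refine ⟨hM, fun t => ?_, fun t x => ?_, fun t x y => ?_, ?_, hEuler.pressure_periodic,
    hEuler.pressure_integrable, fun φ hφ l => ?_, fun φ hφ => ?_⟩
  · by_cases ht : t ∈ S
    · rw [hwS t ht]
      exact hEuler.velocity_periodic t ht.1
    · rw [hw0 t ht]
      exact fun _ _ _ => rfl
  · by_cases ht : t ∈ S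
    · rw [hwS t ht]
      exact ht.2.1 x
    · simpa [hw0 t ht] using hM
  · by_cases ht : t ∈ S
    · rw [hwS t ht]
      exact ht.2.2 x y
    · rw [hw0 t ht]
      simp only [Pi.zero_apply, sub_self, norm_zero]
      positivity
  · refine ((aestronglyMeasurable_indicator_iff hIm).2 hEuler.velocity_measurable).congr ?_
    filter_upwards [hae] with z hz
    by_cases hzI : z ∈ I ×ˢ (univ : Set (E n))
    · rw [indicator_of_mem hzI, hz hzI]
    · have : z.1 ∉ S := fun h' => hzI ⟨h'.1, mem_univ _⟩
      rw [indicator_of_notMem hzI, hw0 _ this, Pi.zero_apply]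
  · rw [← hEuler.momentum φ hφ l]
    refine setIntegral_congr_ae hIm ?_
    filter_upwards [hae] with z hz hzI
    rw [hz hzI]
  · rw [← hEuler.incompressible φ hφ]
    refine setIntegral_congr_ae hIm ?_
    filter_upwards [hae] with z hz hzI
    rw [hz hzI]

/-- If the velocity is bounded and continuous in space at the times in `T` and is continuous in
time at each point, then the energy is continuous along `T`. -/
lemma tendsto_energy {v : ℝ → E n → E n} {T : Set ℝ} (hTI : T ⊆ I)
    (hvc : ∀ t ∈ T, Continuous (v t)) (hvM : ∀ t ∈ T, ∀ x, ‖v t x‖ ≤ M)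
    (hcont : ∀ x, ContinuousOn (fun t => v t x) I) {t : ℝ} (ht : t ∈ I) :
    Tendsto (energy b v) (𝓝[T] t) (𝓝 (energy b v t)) := by
  refine tendsto_integral_filter_of_dominated_convergence (fun _ => M ^ 2 / 2) ?_ ?_
    (integrable_const _) (.of_forall fun x => ?_)
  · filter_upwards [self_mem_nhdsWithin] with r hr
    exact (((hvc r hr).norm.pow 2).div_const 2).aestronglyMeasurable
  · filter_upwards [self_mem_nhdsWithin] with r hr
    refine .of_forall fun x => ?_
    rw [Real.norm_of_nonneg (by positivity)]
    gcongr
    exact hvM r hr x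
  · exact ((((hcont x) t ht).mono_left (nhdsWithin_mono t hTI)).norm.pow 2).div_const 2

end EnergyRegularity

end EulerTorus

/-! ### From almost every time to every time. -/

theorem theorem1p5 {n : ℕ} (hn : 2 ≤ n)
    (b : Module.Basis (Fin n) ℝ (EulerTorus.E n))
    (I : Set ℝ) (hIopen : IsOpen I) (hIinterval : I.OrdConnected)
    (α : ℝ) (hα0 : 0 < α) (hα1 : α < 1)
    (v : ℝ → EulerTorus.E n → EulerTorus.E n) (p : ℝ → EulerTorus.E n → ℝ)
    (hEuler : EulerTorus.IsEulerSolution b I v p)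
    (hp : EulerTorus.PressureNormalized b I p)
    (hv : EulerTorus.BoundedHolder α I v) :
    ∃ C : ℝ,
      (∃ T ⊆ I, volume (I \ T) = 0 ∧
        ∀ t Δt : ℝ, t ∈ T → t + Δt ∈ T →
          |EulerTorus.energy b v (t + Δt) - EulerTorus.energy b v t|
            ≤ C * |Δt| ^ (2 * α / (1 - α))) ∧
      ((∀ x, ContinuousOn (fun t => v t x) I) →
        ∀ t Δt : ℝ, t ∈ I → t + Δt ∈ I →
          |EulerTorus.energy b v (t + Δt) - EulerTorus.energy b v t|
            ≤ C * |Δt| ^ (2 * α / (1 - α))) := by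
  obtain ⟨M, w, hw, hvw⟩ :=
    EulerTorus.exists_boundedSolution hIopen.measurableSet hEuler hv
  obtain ⟨C, T₀, hT₀, hC⟩ := hw.exists_energy_bound hα0 hα1 hIopen hIinterval
  set T : Set ℝ := I ∩ {t | t ∈ T₀ ∧ (t ∈ I → v t = w t)} with hT
  have hae : ∀ᵐ t, t ∈ T₀ ∧ (t ∈ I → v t = w t) := hT₀.and hvw
  have hTI : T ⊆ I := inter_subset_left
  have hvT : ∀ t ∈ T, v t = w t := fun t ht => ht.2.2 ht.1
  have hbound : ∀ s t, s ∈ T → t ∈ T →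
      |EulerTorus.energy b v t - EulerTorus.energy b v s| ≤
        C * |t - s| ^ (2 * α / (1 - α)) := by
    intro s t hs ht
    have := hC s t hs.2.1 ht.2.1 hs.1 ht.1
    simpa only [EulerTorus.energy, hvT s hs, hvT t ht] using this
  refine ⟨C, ⟨T, hTI, ?_, fun t Δt ht ht' => ?_⟩, fun hcont t Δt ht ht' => ?_⟩
  · refine measure_mono_null (fun t ht hmem => ht.2 ⟨ht.1, hmem⟩) (ae_iff.1 hae)
  · simpa using hbound t (t + Δt) ht ht'
  · have hlim : ∀ r ∈ I, Filter.Tendsto (EulerTorus.energy b v) (nhdsWithin r T)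
        (nhds (EulerTorus.energy b v r)) := fun r hr =>
      EulerTorus.tendsto_energy hTI (fun r hr => by rw [hvT r hr]; exact hw.continuous hα0 r)
        (fun r hr x => by rw [hvT r hr]; exact hw.bound r x) hcont hr
    -- T has full measure in the open set I, so every time in I is a limit of times in T.
    have hne : ∀ r ∈ I, (nhdsWithin r T).NeBot := fun r hr =>
      mem_closure_iff_nhdsWithin_neBot.1
        ((Measure.dense_of_ae hae).open_subset_closure_inter hIopen hr)
    have := hne t ht
    have := hne _ ht'
    have hβ : 0 < 2 * α / (1 - α) := div_pos (by positivity) (sub_pos.2 hα1)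
    have hid : ∀ r, Filter.Tendsto (fun r : ℝ => r) (nhdsWithin r T) (nhds r) := fun r =>
      Filter.tendsto_id.mono_left nhdsWithin_le_nhds
    have h1 := (((hlim _ ht').comp Filter.tendsto_snd).sub
      ((hlim t ht).comp (Filter.tendsto_fst (g := nhdsWithin (t + Δt) T)))).abs
    have h2 := ((((hid (t + Δt)).comp Filter.tendsto_snd).sub
      ((hid t).comp (Filter.tendsto_fst (g := nhdsWithin (t + Δt) T)))).abs.rpow_const
        (p := 2 * α / (1 - α)) (.inr hβ.le)).const_mul C
    rw [add_sub_cancel_left] at h2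
    -- The two times approach t and t + Δt independently within T, along the product filter, and the
    -- bound with the same C passes to the limit.
    refine le_of_tendsto_of_tendsto h1 h2 ?_
    filter_upwards [Filter.prod_mem_prod self_mem_nhdsWithin self_mem_nhdsWithin] with z hz
    exact hbound z.1 z.2 hz.1 hz.2
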